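/- Let $\tau=\frac{\sqrt5-1}{2}$ and let $T_\tau$ be the golden ratio Thompson group, i.e. the group of all orientation preserving piecewise linear homeomorphisms $g$ of the circle $\mathbf R/\mathbf Z$ such that (1) $g$ has finitely many breakpoints, all of which lie in $\mathbf Z[\tau]/\mathbf Z$; (2) every slope of $g$, wherever it is defined, is an integral power of $\tau$; and (3) $g$ preserves $\mathbf Z[\tau]/\mathbf Z$, i.e. $g(\mathbf Z[\tau]/\mathbf Z)=\mathbf Z[\tau]/\mathbf Z$. Call a group $G$ $n$-uniformly simple ($n\in\mathbf N$) if for all $f,g\in G\setminus\{\mathrm{id}\}$ the element $f$ is a product of at most $n$ conjugates (in $G$) of the elements $g,g^{-1}$, and uniformly simple if it is $n$-uniformly simple for some $n\in\mathbf N$. Then the commutator subgroup $T_\tau'$ of $T_\tau$ is uniformly simple. More precisely, $T_\tau'$ is $24$-uniformly simple: for all nontrivial $f,g\in T_\tau'$, the element $f$ is a product of at most $24$ elements, each of which is conjugate in $T_\tau'$ to $g$ or to $g^{-1}$. -/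

import Mathlib

open scoped Topology

/-- The small golden ratio `τ = (√5 - 1) / 2`. -/
noncomputable def smallGolden : ℝ := (Real.sqrt 5 - 1) / 2

/-- The set `ℤ[τ]/ℤ ⊆ ℝ/ℤ`, the image of the subring `ℤ[τ]` of `ℝ`. -/
def goldenPoints : Set UnitAddCircle :=
  (fun r : ℝ => (r : UnitAddCircle)) '' (Algebra.adjoin ℤ {smallGolden} : Set ℝ)

/-- A homeomorphism of the circle `ℝ/ℤ` preserves orientation if it lifts to an increasing
bijection of `ℝ` commuting with `x ↦ x + 1`: the units of the monoid `CircleDeg1Lift` of monotone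
degree one maps are exactly these bijections. -/
def OrientationPreserving (f : UnitAddCircle ≃ₜ UnitAddCircle) : Prop :=
  ∃ F : CircleDeg1Liftˣ, ∀ r : ℝ, f (r : UnitAddCircle) = ((F : CircleDeg1Lift) r : ℝ)

/-- `f` is affine with slope `s` on a neighbourhood of the point `x` of `ℝ/ℤ`. -/
def HasSlopeAt (f : UnitAddCircle ≃ₜ UnitAddCircle) (s : ℝ) (x : UnitAddCircle) : Prop :=
  ∀ᶠ t : ℝ in 𝓝 0, f (x + (t : UnitAddCircle)) = f x + ((s * t : ℝ) : UnitAddCircle)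

/-- `f` is piecewise linear with finitely many breakpoints, all of them in `ℤ[τ]/ℤ`, and all its
slopes are integral powers of `τ`. -/
def IsGoldenPL (f : UnitAddCircle ≃ₜ UnitAddCircle) : Prop :=
  ∃ B : Set UnitAddCircle, B.Finite ∧ B ⊆ goldenPoints ∧
    ∀ x ∉ B, ∃ n : ℤ, HasSlopeAt f (smallGolden ^ n) x

theorem smallGolden_pos : 0 < smallGolden := by
  have h : (1 : ℝ) < Real.sqrt 5 := by
    rw [Real.lt_sqrt] <;> norm_num
  unfold smallGolden
  linarith

theorem hasSlopeAt_mul {f g : UnitAddCircle ≃ₜ UnitAddCircle} {s t : ℝ} {x : UnitAddCircle}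
    (hf : HasSlopeAt f s (g x)) (hg : HasSlopeAt g t x) : HasSlopeAt (f * g) (s * t) x := by
  have hlim : Filter.Tendsto (fun u : ℝ => t * u) (𝓝 0) (𝓝 0) := by
    have h : Continuous (fun u : ℝ => t * u) := by fun_prop
    simpa using h.tendsto 0
  filter_upwards [hg, hlim.eventually hf] with u h1 h2
  change f (g (x + (u : UnitAddCircle))) = f (g x) + _
  rw [h1, h2, mul_assoc]

theorem hasSlopeAt_inv {f : UnitAddCircle ≃ₜ UnitAddCircle} {s : ℝ} {x : UnitAddCircle}
    (hs : s ≠ 0) (hf : HasSlopeAt f s (f⁻¹ x)) : HasSlopeAt f⁻¹ s⁻¹ x := by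
  have hlim : Filter.Tendsto (fun u : ℝ => s⁻¹ * u) (𝓝 0) (𝓝 0) := by
    have h : Continuous (fun u : ℝ => s⁻¹ * u) := by fun_prop
    simpa using h.tendsto 0
  have hx : f (f⁻¹ x) = x := f.apply_symm_apply x
  filter_upwards [hlim.eventually hf] with u h1
  rw [hx, mul_inv_cancel_left₀ hs] at h1
  rw [← h1]
  exact f.symm_apply_apply _

/-- The golden ratio Thompson group `T_τ`: the orientation preserving piecewise linear
homeomorphisms of `ℝ/ℤ` with finitely many breakpoints, all in `ℤ[τ]/ℤ`, whose slopes are powers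
of `τ`, and which preserve `ℤ[τ]/ℤ`. -/
def goldenT : Subgroup (UnitAddCircle ≃ₜ UnitAddCircle) where
  carrier := {f | OrientationPreserving f ∧ IsGoldenPL f ∧ f '' goldenPoints = goldenPoints}
  mul_mem' := by
    rintro f g ⟨⟨F, hF⟩, ⟨B, hBf, hBs, hB⟩, hf⟩ ⟨⟨G, hG⟩, ⟨C, hCf, hCs, hC⟩, hg⟩
    refine ⟨⟨F * G, fun r => ?_⟩, ⟨C ∪ g ⁻¹' B, ?_, ?_, ?_⟩, ?_⟩
    · change f (g r) = _
      rw [hG, hF]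
      rfl
    · exact hCf.union (hBf.preimage g.injective.injOn)
    · rintro x (hx | hx)
      · exact hCs hx
      · have h1 : g x ∈ g '' goldenPoints := hg.symm ▸ hBs hx
        exact (g.injective.mem_set_image).1 h1
    · intro x hx
      rw [Set.mem_union, not_or] at hx
      obtain ⟨n, hn⟩ := hC x hx.1
      obtain ⟨m, hm⟩ := hB (g x) hx.2
      refine ⟨m + n, ?_⟩
      rw [zpow_add₀ smallGolden_pos.ne']
      exact hasSlopeAt_mul hm hn
    · change (fun x => f (g x)) '' goldenPoints = _
      rw [← Set.image_image f g, hg, hf]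
  one_mem' := by
    refine ⟨⟨1, fun r => rfl⟩, ⟨∅, Set.finite_empty, Set.empty_subset _, fun x _ => ⟨0, ?_⟩⟩, ?_⟩
    · refine Filter.Eventually.of_forall fun t => ?_
      change x + (t : UnitAddCircle) = x + _
      simp
    · change (fun x => x) '' goldenPoints = _
      simp
  inv_mem' := by
    rintro f ⟨⟨F, hF⟩, ⟨B, hBf, hBs, hB⟩, hf⟩
    refine ⟨⟨F⁻¹, fun r => ?_⟩, ⟨f '' B, hBf.image f, ?_, ?_⟩, ?_⟩
    · apply f.injective
      rw [hF, CircleDeg1Lift.units_apply_inv_apply]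
      exact f.apply_symm_apply _
    · rw [← hf]
      exact Set.image_mono hBs
    · intro x hx
      have hx' : f⁻¹ x ∉ B := fun h => hx ⟨_, h, f.apply_symm_apply x⟩
      obtain ⟨n, hn⟩ := hB _ hx'
      refine ⟨-n, ?_⟩
      rw [zpow_neg]
      exact hasSlopeAt_inv (zpow_pos smallGolden_pos n).ne' hn
    · change f.symm '' goldenPoints = _
      conv_lhs => rw [← hf]
      rw [Set.image_image]
      simp

/-- A group is `n`-uniformly simple if, for all nontrivial `f` and `g`, the element `f` is a
product of at most `n` conjugates of `g` and `g⁻¹`. -/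
def IsNUniformlySimple (n : ℕ) (G : Type*) [Group G] : Prop :=
  ∀ f g : G, f ≠ 1 → g ≠ 1 →
    ∃ l : List G, l.length ≤ n ∧ (∀ h ∈ l, IsConj g h ∨ IsConj g⁻¹ h) ∧ l.prod = f

/-- A group is uniformly simple if it is `n`-uniformly simple for some `n`. -/
def IsUniformlySimple (G : Type*) [Group G] : Prop :=
  ∃ n : ℕ, IsNUniformlySimple n G

/-! The argument takes place on the line. An element of `goldenT` lifts to a golden PL homeomorphism
commuting with `x ↦ x + 1`, and an element of the commutator subgroup lifts to `⁅periodic 1,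
periodic 1⁆`; integer translations of a lift are invisible on the circle.

Displacement. If `g` moves an interval off itself and `a`, `b` live on that interval, then `⁅a, b⁆ =
⁅⁅a, g⁆, b⁆` is a product of four conjugates of `g` and `g⁻¹` (`isProdConj_commutator`). Since the
group is transitive on intervals with end points in `ℤ[τ]` (`exists_goldenPL_interval`), an element
of `⁅bddSupp, bddSupp⁆` supported in an open unit interval can be conjugated into a small displaced
interval. There it is a product of only two commutators (`eq_two_commutators`), whose entries can be
taken in the commutator subgroup (`commutatorElement_eq_of_push`). Its periodic extension therefore
costs 8 conjugates (`isProdConj_periodize`).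

Decomposition. A lift `f` agrees near `0` with the periodization `d` of a product of commutators,
and `d⁻¹ * f` is the identity near `0`, so it is the periodization of some `m` supported inside `(0,
1)`. The remaining obstruction is the class of `m` in the abelianization of `bddSupp`. The
homomorphism `psi 1` on `periodic 1` computes this class and kills commutators. Adjusting the lift
by translations requires `psi 1 (shift 2) = 0`, a consequence of `τ + τ² = 1` (`psi_one_shift_two`).
Even translations bring `f 0` into `(-1, 1]`. Two factors suffice on the open interval, giving 16
conjugates; the end point `1` needs a third factor, giving 24. -/

open scoped commutatorElement

/-! ### The ring `ℤ[τ]` -/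

/-- The ring `ℤ[τ]` as a subring of `ℝ`. -/
noncomputable def goldenRing : Subring ℝ := (Algebra.adjoin ℤ {smallGolden}).toSubring

theorem smallGolden_sq : smallGolden ^ 2 = 1 - smallGolden := by
  have h : Real.sqrt 5 ^ 2 = 5 := Real.sq_sqrt (by norm_num)
  unfold smallGolden
  linarith [h]

theorem smallGolden_lt_one : smallGolden < 1 := by
  nlinarith [smallGolden_sq, smallGolden_pos]

theorem smallGolden_mem : smallGolden ∈ goldenRing :=
  Algebra.subset_adjoin (Set.mem_singleton _)

theorem mem_goldenRing_iff {x : ℝ} :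
    x ∈ goldenRing ↔ ∃ p q : ℤ, x = p + q * smallGolden := by
  constructor
  · intro hx
    change x ∈ Algebra.adjoin ℤ {smallGolden} at hx
    induction hx using Algebra.adjoin_induction with
    | mem x hx => exact ⟨0, 1, by simp [Set.mem_singleton_iff.1 hx]⟩
    | algebraMap r => exact ⟨r, 0, by simp⟩
    | add x y _ _ hx hy =>
      obtain ⟨p, q, rfl⟩ := hx
      obtain ⟨p', q', rfl⟩ := hy
      exact ⟨p + p', q + q', by push_cast; ring⟩
    | mul x y _ _ hx hy =>
      obtain ⟨p, q, rfl⟩ := hx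
      obtain ⟨p', q', rfl⟩ := hy
      refine ⟨p * p' + q * q', p * q' + q * p' - q * q', ?_⟩
      push_cast
      linear_combination (q : ℝ) * q' * smallGolden_sq
  · rintro ⟨p, q, rfl⟩
    exact add_mem (intCast_mem _ _) (mul_mem (intCast_mem _ _) smallGolden_mem)

theorem smallGolden_inv : smallGolden⁻¹ = 1 + smallGolden := by
  refine inv_eq_of_mul_eq_one_right ?_
  linear_combination smallGolden_sq

theorem smallGolden_zpow_pos (n : ℤ) : 0 < smallGolden ^ n := zpow_pos smallGolden_pos n

theorem smallGolden_zpow_mem (n : ℤ) : smallGolden ^ n ∈ goldenRing := by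
  obtain ⟨k, rfl | rfl⟩ := n.eq_nat_or_neg
  · exact_mod_cast pow_mem smallGolden_mem k
  · rw [zpow_neg, zpow_natCast, ← inv_pow, smallGolden_inv]
    exact pow_mem (add_mem (one_mem _) smallGolden_mem) k

theorem exists_goldenRing_between {x y : ℝ} (h : x < y) : ∃ m ∈ goldenRing, x < m ∧ m < y := by
  have hd : Dense (goldenRing.toAddSubgroup : Set ℝ) := by
    refine AddSubgroup.dense_of_not_isolated_zero _ fun ε hε => ?_
    obtain ⟨n, hn⟩ := exists_pow_lt_of_lt_one hε smallGolden_lt_one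
    exact ⟨smallGolden ^ n, pow_mem smallGolden_mem n, pow_pos smallGolden_pos n, hn⟩
  obtain ⟨m, hm, h1, h2⟩ := hd.exists_between h
  exact ⟨m, hm, h1, h2⟩

/-! ### Piecewise linear homeomorphisms of the line -/

/-- `F` is affine at `x` from each side, with slopes integral powers of `τ`, and it is affine near
`x` when `x` is not in `ℤ[τ]`. -/
structure GoldenAt (F : ℝ → ℝ) (x : ℝ) : Prop where
  right : ∃ n : ℤ, ∀ᶠ y in 𝓝[≥] x, F y = F x + smallGolden ^ n * (y - x)
  left : ∃ n : ℤ, ∀ᶠ y in 𝓝[≤] x, F y = F x + smallGolden ^ n * (y - x)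
  both : x ∉ goldenRing → ∃ n : ℤ, ∀ᶠ y in 𝓝 x, F y = F x + smallGolden ^ n * (y - x)

theorem GoldenAt.congr {F H : ℝ → ℝ} {x : ℝ} (hF : GoldenAt F x) (h : F =ᶠ[𝓝 x] H) :
    GoldenAt H x := by
  have hx : F x = H x := h.eq_of_nhds
  obtain ⟨⟨n, hn⟩, ⟨m, hm⟩, hb⟩ := hF
  refine ⟨⟨n, ?_⟩, ⟨m, ?_⟩, fun h' => ?_⟩
  · filter_upwards [hn, h.filter_mono nhdsWithin_le_nhds] with y h1 h2
    rw [← h2, h1, hx]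
  · filter_upwards [hm, h.filter_mono nhdsWithin_le_nhds] with y h1 h2
    rw [← h2, h1, hx]
  · obtain ⟨k, hk⟩ := hb h'
    refine ⟨k, ?_⟩
    filter_upwards [hk, h] with y h1 h2
    rw [← h2, h1, hx]

theorem tendsto_ge_of_monotone {F : ℝ → ℝ} (hF : Continuous F) (hm : Monotone F) (x : ℝ) :
    Filter.Tendsto F (𝓝[≥] x) (𝓝[≥] (F x)) :=
  hF.continuousWithinAt.tendsto_nhdsWithin fun _ hy => hm hy

theorem tendsto_le_of_monotone {F : ℝ → ℝ} (hF : Continuous F) (hm : Monotone F) (x : ℝ) :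
    Filter.Tendsto F (𝓝[≤] x) (𝓝[≤] (F x)) :=
  hF.continuousWithinAt.tendsto_nhdsWithin fun _ hy => hm hy

/-- The group of all golden piecewise linear homeomorphisms of the line. -/
def goldenPL : Subgroup (ℝ ≃o ℝ) where
  carrier := {F | (∀ x, F x ∈ goldenRing ↔ x ∈ goldenRing) ∧ ∀ x, GoldenAt F x}
  one_mem' := by
    refine ⟨fun x => Iff.rfl, fun x => ⟨⟨0, ?_⟩, ⟨0, ?_⟩, fun _ => ⟨0, ?_⟩⟩⟩ <;>
    exact Filter.Eventually.of_forall fun y => by simp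
  mul_mem' := by
    rintro F H ⟨hF, hF'⟩ ⟨hH, hH'⟩
    refine ⟨fun x => (hF _).trans (hH _), fun x => ?_⟩
    obtain ⟨⟨n, hn⟩, ⟨m, hm⟩, hb⟩ := hF' (H x)
    obtain ⟨⟨n', hn'⟩, ⟨m', hm'⟩, hb'⟩ := hH' x
    refine ⟨⟨n + n', ?_⟩, ⟨m + m', ?_⟩, fun hx => ?_⟩
    · filter_upwards [hn', (tendsto_ge_of_monotone H.continuous H.monotone x).eventually hn]
        with y h1 h2
      rw [RelIso.mul_apply, RelIso.mul_apply, h2, h1, zpow_add₀ smallGolden_pos.ne']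
      ring
    · filter_upwards [hm', (tendsto_le_of_monotone H.continuous H.monotone x).eventually hm]
        with y h1 h2
      rw [RelIso.mul_apply, RelIso.mul_apply, h2, h1, zpow_add₀ smallGolden_pos.ne']
      ring
    · obtain ⟨k, hk⟩ := hb (fun h => hx ((hH x).1 h))
      obtain ⟨k', hk'⟩ := hb' hx
      refine ⟨k + k', ?_⟩
      filter_upwards [hk', (H.continuous.tendsto x).eventually hk] with y h1 h2
      rw [RelIso.mul_apply, RelIso.mul_apply, h2, h1, zpow_add₀ smallGolden_pos.ne']
      ring
  inv_mem' := by
    rintro F ⟨hF, hF'⟩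
    have key : ∀ (n : ℤ) (x y : ℝ), F (F⁻¹ y) = F (F⁻¹ x) + smallGolden ^ n * (F⁻¹ y - F⁻¹ x) →
        F⁻¹ y = F⁻¹ x + smallGolden ^ (-n) * (y - x) := by
      intro n x y h
      rw [RelIso.apply_inv_self, RelIso.apply_inv_self] at h
      rw [zpow_neg, show y - x = smallGolden ^ n * (F⁻¹ y - F⁻¹ x) by linarith,
        inv_mul_cancel_left₀ (smallGolden_zpow_pos n).ne']
      ring
    refine ⟨fun x => ?_, fun x => ?_⟩
    · rw [← hF, RelIso.apply_inv_self]
    obtain ⟨⟨n, hn⟩, ⟨m, hm⟩, hb⟩ := hF' (F⁻¹ x)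
    have hc : Continuous (F⁻¹ : ℝ ≃o ℝ) := OrderIso.continuous _
    have hmono : Monotone (F⁻¹ : ℝ ≃o ℝ) := OrderIso.monotone _
    refine ⟨⟨-n, ?_⟩, ⟨-m, ?_⟩, fun hx => ?_⟩
    · filter_upwards [(tendsto_ge_of_monotone hc hmono x).eventually hn] with y h1
      exact key _ _ _ h1
    · filter_upwards [(tendsto_le_of_monotone hc hmono x).eventually hm] with y h1
      exact key _ _ _ h1
    · obtain ⟨k, hk⟩ := hb (fun h => hx (by rwa [← hF, RelIso.apply_inv_self] at h))
      refine ⟨-k, ?_⟩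
      filter_upwards [(hc.tendsto x).eventually hk] with y h1
      exact key _ _ _ h1

theorem goldenPL_apply_mem {F : ℝ ≃o ℝ} (hF : F ∈ goldenPL) {x : ℝ} (hx : x ∈ goldenRing) :
    F x ∈ goldenRing := (hF.1 x).2 hx

/-- The affine map `x ↦ τ ^ n * x + c`. -/
noncomputable def goldenAffine (n : ℤ) (c : ℝ) : ℝ ≃o ℝ :=
  (OrderIso.mulLeft₀ (smallGolden ^ n) (smallGolden_zpow_pos n)).trans (OrderIso.addRight c)

theorem goldenAffine_apply (n : ℤ) (c x : ℝ) : goldenAffine n c x = smallGolden ^ n * x + c := rfl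

theorem goldenAffine_mem (n : ℤ) {c : ℝ} (hc : c ∈ goldenRing) : goldenAffine n c ∈ goldenPL := by
  refine ⟨fun x => ⟨fun h => ?_, fun h => ?_⟩, fun x => ⟨⟨n, ?_⟩, ⟨n, ?_⟩, fun _ => ⟨n, ?_⟩⟩⟩
  · have h1 := mul_mem (smallGolden_zpow_mem (-n)) (sub_mem h hc)
    rwa [goldenAffine_apply, add_sub_cancel_right, zpow_neg,
      inv_mul_cancel_left₀ (smallGolden_zpow_pos n).ne'] at h1
  · exact add_mem (mul_mem (smallGolden_zpow_mem n) h) hc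
  all_goals
    refine Filter.Eventually.of_forall fun y => ?_
    rw [goldenAffine_apply, goldenAffine_apply]
    ring

/-- The translation by `c`. -/
noncomputable def shift (c : ℝ) : ℝ ≃o ℝ := OrderIso.addRight c

@[simp] theorem shift_apply (c x : ℝ) : shift c x = x + c := rfl

@[simp] theorem shift_inv_apply (c x : ℝ) : (shift c)⁻¹ x = x - c := by
  apply (shift c).injective
  rw [RelIso.apply_inv_self]
  simp

theorem shift_mem {c : ℝ} (hc : c ∈ goldenRing) : shift c ∈ goldenPL := by
  have h : shift c = goldenAffine 0 c := by
    ext x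
    simp [goldenAffine_apply]
  rw [h]
  exact goldenAffine_mem 0 hc

/-! ### Gluing -/

/-- The map that is `F` to the left of `a` and `H` to the right of `a`. -/
noncomputable def glue (F H : ℝ ≃o ℝ) (a : ℝ) (h : F a = H a) : ℝ ≃o ℝ :=
  StrictMono.orderIsoOfSurjective (fun x => if x ≤ a then F x else H x)
    (by
      intro x y hxy
      dsimp only
      split_ifs with h1 h2 h2
      · exact F.strictMono hxy
      · exact (F.monotone h1).trans_lt (h ▸ H.strictMono (not_le.1 h2))
      · exact absurd (hxy.le.trans h2) h1
      · exact H.strictMono hxy)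
    (by
      intro y
      rcases le_total y (F a) with h1 | h1
      · refine ⟨F.symm y, ?_⟩
        dsimp only
        rw [if_pos (F.symm_apply_le.2 h1), F.apply_symm_apply]
      · refine ⟨H.symm y, ?_⟩
        dsimp only
        split_ifs with h2
        · have h3 : y ≤ H a := H.symm_apply_le.1 h2
          have h4 : y = H a := le_antisymm h3 (h ▸ h1)
          rw [h4, H.symm_apply_apply, h]
        · exact H.apply_symm_apply y)

section glue
variable {F H : ℝ ≃o ℝ} {a : ℝ} {h : F a = H a}

theorem glue_of_le {x : ℝ} (hx : x ≤ a) : glue F H a h x = F x := if_pos hx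

theorem glue_of_ge {x : ℝ} (hx : a ≤ x) : glue F H a h x = H x := by
  rcases hx.eq_or_lt with rfl | hx
  · rw [glue_of_le le_rfl, h]
  · exact if_neg (not_le.2 hx)

theorem glue_mem (hF : F ∈ goldenPL) (hH : H ∈ goldenPL) (ha : a ∈ goldenRing) :
    glue F H a h ∈ goldenPL := by
  refine ⟨fun x => ?_, fun x => ?_⟩
  · rcases le_total x a with hx | hx
    · rw [glue_of_le hx, hF.1]
    · rw [glue_of_ge hx, hH.1]
  · rcases lt_trichotomy x a with hx | rfl | hx
    · refine (hF.2 x).congr ?_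
      filter_upwards [Iio_mem_nhds hx] with y hy
      rw [glue_of_le (le_of_lt hy)]
    · refine ⟨?_, ?_, fun h => absurd ha h⟩
      · obtain ⟨n, hn⟩ := (hH.2 x).right
        refine ⟨n, ?_⟩
        filter_upwards [hn, self_mem_nhdsWithin] with y h1 h2
        rw [glue_of_ge h2, glue_of_ge le_rfl, h1]
      · obtain ⟨n, hn⟩ := (hF.2 x).left
        refine ⟨n, ?_⟩
        filter_upwards [hn, self_mem_nhdsWithin] with y h1 h2
        rw [glue_of_le h2, glue_of_le le_rfl, h1]
    · refine (hH.2 x).congr ?_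
      filter_upwards [Ioi_mem_nhds hx] with y hy
      rw [glue_of_ge (le_of_lt hy)]

end glue

/-! ### Transitivity on intervals -/

/-- There is a golden piecewise linear homeomorphism carrying `[0, x]` to `[0, y]`. -/
def LengthEquiv (x y : ℝ) : Prop := ∃ F ∈ goldenPL, F 0 = 0 ∧ F x = y

theorem LengthEquiv.symm {x y : ℝ} (h : LengthEquiv x y) : LengthEquiv y x := by
  obtain ⟨F, hF, h0, hx⟩ := h
  refine ⟨F⁻¹, inv_mem hF, ?_, ?_⟩
  · apply F.injective
    rw [RelIso.apply_inv_self, h0]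
  · apply F.injective
    rw [RelIso.apply_inv_self, hx]

theorem LengthEquiv.trans {x y z : ℝ} (h : LengthEquiv x y) (h' : LengthEquiv y z) :
    LengthEquiv x z := by
  obtain ⟨F, hF, h0, hx⟩ := h
  obtain ⟨H, hH, h0', hx'⟩ := h'
  refine ⟨H * F, mul_mem hH hF, ?_, ?_⟩ <;> simp [*]

theorem lengthEquiv_zpow (n : ℤ) (x : ℝ) : LengthEquiv x (smallGolden ^ n * x) :=
  ⟨goldenAffine n 0, goldenAffine_mem n (zero_mem _), by simp [goldenAffine_apply],
    by simp [goldenAffine_apply]⟩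

theorem LengthEquiv.add {x y x' y' : ℝ} (h : LengthEquiv x y) (h' : LengthEquiv x' y')
    (hx : 0 ≤ x) (hx' : 0 ≤ x') (hxM : x ∈ goldenRing) : LengthEquiv (x + x') (y + y') := by
  obtain ⟨F, hF, h0, h1⟩ := h
  obtain ⟨H, hH, h0', h1'⟩ := h'
  have hyM : y ∈ goldenRing := h1 ▸ goldenPL_apply_mem hF hxM
  have e : F x = (shift y * H * (shift x)⁻¹) x := by simp [h0', h1]
  refine ⟨glue F (shift y * H * (shift x)⁻¹) x e,
    glue_mem hF (mul_mem (mul_mem (shift_mem hyM) hH) (inv_mem (shift_mem hxM))) hxM, ?_, ?_⟩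
  · rw [glue_of_le hx, h0]
  · rw [glue_of_ge (by linarith)]
    simp [h1', add_comm]

/-- The source of all length equivalences is `τ + τ² = 1`: two unit intervals, rescaled by `τ` and
`τ²`, fill one unit interval. -/
theorem lengthEquiv_natCast_succ (n : ℕ) : LengthEquiv ((n : ℝ) + 1) 1 := by
  have two : LengthEquiv ((1 : ℝ) + 1) 1 := by
    have h1 := (lengthEquiv_zpow 1 1).add (lengthEquiv_zpow 2 1) zero_le_one zero_le_one
      (one_mem _)
    have h2 : smallGolden ^ (1 : ℤ) * 1 + smallGolden ^ (2 : ℤ) * 1 = 1 := by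
      rw [zpow_one, zpow_ofNat, smallGolden_sq]
      ring
    rwa [h2] at h1
  induction n with
  | zero => exact ⟨1, one_mem _, rfl, by simp⟩
  | succ k ih =>
    refine LengthEquiv.trans ?_ two
    push_cast
    exact ih.add ⟨1, one_mem _, rfl, rfl⟩ (by positivity) zero_le_one
      (add_mem (natCast_mem _ _) (one_mem _))

theorem lengthEquiv_one_of_nonneg {p q : ℕ} (h : 0 < (p : ℝ) + q * smallGolden) :
    LengthEquiv ((p : ℝ) + q * smallGolden) 1 := by
  have hq : ∀ k : ℕ, LengthEquiv ((k + 1 : ℕ) * smallGolden) 1 := by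
    intro k
    have h1 := (lengthEquiv_zpow 1 ((k : ℝ) + 1)).symm.trans (lengthEquiv_natCast_succ k)
    rw [zpow_one, mul_comm] at h1
    exact_mod_cast h1
  rcases p with _ | p
  · rcases q with _ | q
    · simp at h
    · simpa using hq q
  · rcases q with _ | q
    · simpa using lengthEquiv_natCast_succ p
    · have h1 := lengthEquiv_natCast_succ p
      refine LengthEquiv.trans (y := 1 + 1) ?_ (by simpa using lengthEquiv_natCast_succ 1)
      refine LengthEquiv.add (by exact_mod_cast h1) (hq q) (by positivity) ?_ (natCast_mem _ _)
      have := smallGolden_pos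
      positivity

/-- Scaling by `τ⁻¹ = 1 + τ` acts on coefficients as the Fibonacci step `(p, q) ↦ (p + q, p)`. -/
theorem lengthEquiv_one_step {p q : ℤ}
    (h : LengthEquiv (((p + q : ℤ) : ℝ) + p * smallGolden) 1) :
    LengthEquiv ((p : ℝ) + q * smallGolden) 1 := by
  refine LengthEquiv.trans ?_ h
  have h1 := (lengthEquiv_zpow 1 (((p + q : ℤ) : ℝ) + p * smallGolden)).symm
  convert h1 using 1
  push_cast
  rw [zpow_one]
  linear_combination -(p : ℝ) * smallGolden_sq

/-- Fibonacci steps eventually make both coefficients nonnegative. Two steps replace `q` by `p + q >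
q`, so the bound `k` drops. -/
theorem lengthEquiv_one_aux (k : ℕ) : ∀ p q : ℤ, 0 < p → -(k : ℤ) ≤ q →
    0 < (p : ℝ) + q * smallGolden → LengthEquiv ((p : ℝ) + q * smallGolden) 1 := by
  induction k with
  | zero =>
    intro p q hp hq h
    lift p to ℕ using hp.le
    lift q to ℕ using (by simpa using hq)
    exact_mod_cast lengthEquiv_one_of_nonneg (by exact_mod_cast h)
  | succ k ih =>
    intro p q hp hq h
    have hτ := smallGolden_pos
    rcases le_or_gt 0 q with h0 | h0
    · exact ih p q hp (by omega) h
    apply lengthEquiv_one_step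
    rcases le_or_gt 0 (p + q) with h1 | h1
    · lift p + q to ℕ using h1 with r hr
      lift p to ℕ using hp.le
      have : (0 : ℝ) < p := by exact_mod_cast hp
      exact_mod_cast lengthEquiv_one_of_nonneg (p := r) (q := p) (by positivity)
    apply lengthEquiv_one_step
    -- Two steps multiply the number by `(1 + τ)²`, so it stays positive; as `p + q < 0`, its new
    -- leading coefficient must be positive.
    have h2 : 0 < ((p + q + p : ℤ) : ℝ) + (p + q : ℤ) * smallGolden := by
      have h3 : ((p + q + p : ℤ) : ℝ) + (p + q : ℤ) * smallGolden =
          (1 + smallGolden) ^ 2 * ((p : ℝ) + q * smallGolden) := by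
        push_cast
        linear_combination (-2 * q - (p : ℝ) - q * (smallGolden - 1)) * smallGolden_sq
      rw [h3]
      positivity
    refine ih _ _ ?_ (by push_cast at hq; omega) h2
    have h4 : (((p + q : ℤ)) : ℝ) < 0 := by exact_mod_cast h1
    have h5 : (0 : ℝ) < ((p + q + p : ℤ) : ℝ) := by nlinarith
    exact_mod_cast h5

theorem lengthEquiv_one {x : ℝ} (hx : x ∈ goldenRing) (h : 0 < x) : LengthEquiv x 1 := by
  obtain ⟨p, q, rfl⟩ := mem_goldenRing_iff.1 hx
  have hτ := smallGolden_pos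
  rcases lt_or_ge 0 p with hp | hp
  · exact lengthEquiv_one_aux q.natAbs p q hp (by omega) h
  -- Here `q > 0`, and `τ < 1` gives `p + q > 0`, so one step reaches the case of positive leading
  -- coefficient.
  · have hp' : (p : ℝ) ≤ 0 := by exact_mod_cast hp
    have hq : (0 : ℝ) < q := by
      by_contra! hq
      nlinarith
    have hpq : (0 : ℝ) < ((p + q : ℤ) : ℝ) := by
      push_cast
      nlinarith [smallGolden_lt_one]
    refine lengthEquiv_one_step (lengthEquiv_one_aux p.natAbs _ _ (by exact_mod_cast hpq)
      (by omega) ?_)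
    have h3 : ((p + q : ℤ) : ℝ) + p * smallGolden =
          (1 + smallGolden) * ((p : ℝ) + q * smallGolden) := by
      push_cast
      linear_combination (-(q : ℝ)) * smallGolden_sq
    rw [h3]
    positivity

/-- Any two compact intervals with end points in `ℤ[τ]` are golden piecewise linearly
homeomorphic. -/
theorem exists_goldenPL_interval {a b c d : ℝ} (ha : a ∈ goldenRing) (hb : b ∈ goldenRing)
    (hc : c ∈ goldenRing) (hd : d ∈ goldenRing) (hab : a < b) (hcd : c < d) :
    ∃ F ∈ goldenPL, F a = c ∧ F b = d := by
  obtain ⟨F, hF, h0, h1⟩ := (lengthEquiv_one (sub_mem hb ha) (sub_pos.2 hab)).trans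
    (lengthEquiv_one (sub_mem hd hc) (sub_pos.2 hcd)).symm
  refine ⟨shift c * F * (shift a)⁻¹,
    mul_mem (mul_mem (shift_mem hc) hF) (inv_mem (shift_mem ha)), ?_, ?_⟩ <;>
  simp [h0, h1]

/-! ### Supports -/

/-- The golden piecewise linear homeomorphisms supported in `[a, b]`. -/
def supp (a b : ℝ) : Subgroup (ℝ ≃o ℝ) where
  carrier := {F | F ∈ goldenPL ∧ ∀ x, x ≤ a ∨ b ≤ x → F x = x}
  one_mem' := ⟨one_mem _, fun _ _ => rfl⟩
  mul_mem' := by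
    rintro F H ⟨hF, hF'⟩ ⟨hH, hH'⟩
    exact ⟨mul_mem hF hH, fun x hx => by rw [RelIso.mul_apply, hH' x hx, hF' x hx]⟩
  inv_mem' := by
    rintro F ⟨hF, hF'⟩
    refine ⟨inv_mem hF, fun x hx => ?_⟩
    apply F.injective
    rw [RelIso.apply_inv_self, hF' x hx]

theorem supp_mono {a b a' b' : ℝ} (ha : a' ≤ a) (hb : b ≤ b') : supp a b ≤ supp a' b' :=
  fun _ h => ⟨h.1, fun x hx => h.2 x (hx.imp (fun h => h.trans ha) (fun h => hb.trans h))⟩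

theorem supp_apply_of_le {a b x : ℝ} {F : ℝ ≃o ℝ} (hF : F ∈ supp a b) (hx : x ≤ a) : F x = x :=
  hF.2 x (Or.inl hx)

theorem supp_apply_of_ge {a b x : ℝ} {F : ℝ ≃o ℝ} (hF : F ∈ supp a b) (hx : b ≤ x) : F x = x :=
  hF.2 x (Or.inr hx)

theorem supp_commute {a b c d : ℝ} (h : b ≤ c) {F H : ℝ ≃o ℝ} (hF : F ∈ supp a b)
    (hH : H ∈ supp c d) : Commute F H := by
  ext x
  rw [RelIso.mul_apply, RelIso.mul_apply]
  rcases le_total x b with hx | hx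
  · have h1 : H x = x := hH.2 x (Or.inl (hx.trans h))
    have h2 : F x ≤ b := by
      rcases le_total a b with hab | hab
      · have h3 : F b = b := hF.2 b (Or.inr le_rfl)
        exact h3 ▸ F.monotone hx
      · rw [hF.2 x (Or.inl (hx.trans hab))]
        exact hx
    rw [h1, hH.2 _ (Or.inl (h2.trans h))]
  · have h1 : F x = x := hF.2 x (Or.inr hx)
    have h2 : b ≤ H x := by
      rcases le_total x c with hxc | hxc
      · rwa [hH.2 x (Or.inl hxc)]
      · have h3 : H c = c := hH.2 c (Or.inl le_rfl)
        exact h.trans (h3 ▸ H.monotone hxc)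
    rw [h1, hF.2 _ (Or.inr h2)]

theorem supp_conj {a b : ℝ} {F k : ℝ ≃o ℝ} (hF : F ∈ supp a b) (hk : k ∈ goldenPL) :
    k * F * k⁻¹ ∈ supp (k a) (k b) := by
  refine ⟨mul_mem (mul_mem hk hF.1) (inv_mem hk), fun x hx => ?_⟩
  have h : F (k⁻¹ x) = k⁻¹ x := by
    refine hF.2 _ (hx.imp (fun h => ?_) fun h => ?_)
    · rw [← k.le_iff_le, RelIso.apply_inv_self]
      exact h
    · rw [← k.le_iff_le, RelIso.apply_inv_self]
      exact h
  rw [RelIso.mul_apply, RelIso.mul_apply, h, RelIso.apply_inv_self]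

/-- The quotient `h⁻¹ * k` is the identity on the support of `F`, hence commutes with `F`. This
allows conjugators of unbounded support to be replaced by bounded ones. -/
theorem conj_eq_of_eqOn {a b : ℝ} {F k h : ℝ ≃o ℝ} (hF : F ∈ supp a b)
    (hkh : ∀ x, a ≤ x → x ≤ b → k x = h x) : k * F * k⁻¹ = h * F * h⁻¹ := by
  have key : Commute (h⁻¹ * k) F := by
    rcases le_or_gt b a with hab | hab
    · have : F = 1 := by
        ext x
        exact hF.2 x ((le_total x a).imp id (fun h => hab.trans h))
      rw [this]
      exact Commute.one_right _
    have e : ∀ x, a ≤ x → x ≤ b → (h⁻¹ * k) x = x := by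
      intro x h1 h2
      rw [RelIso.mul_apply, hkh x h1 h2, RelIso.inv_apply_self]
    ext x
    rw [RelIso.mul_apply, RelIso.mul_apply _ _ x]
    have hFa : F a = a := hF.2 a (Or.inl le_rfl)
    have hFb : F b = b := hF.2 b (Or.inr le_rfl)
    have ea := e a le_rfl hab.le
    have eb := e b hab.le le_rfl
    rcases le_total x a with h1 | h1
    · rw [hF.2 x (Or.inl h1), hF.2 _ (Or.inl ?_)]
      exact ea ▸ (h⁻¹ * k).monotone h1
    rcases le_total b x with h2 | h2
    · rw [hF.2 x (Or.inr h2), hF.2 _ (Or.inr ?_)]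
      exact eb ▸ (h⁻¹ * k).monotone h2
    · rw [e x h1 h2, e]
      · exact hFa ▸ F.monotone h1
      · exact hFb ▸ F.monotone h2
  have h1 : k = h * (h⁻¹ * k) := by group
  rw [h1]
  calc h * (h⁻¹ * k) * F * (h * (h⁻¹ * k))⁻¹ = h * ((h⁻¹ * k) * F) * (h⁻¹ * k)⁻¹ * h⁻¹ := by group
    _ = h * F * h⁻¹ := by rw [key.eq]; group

/-! ### Interpolation and localization of supports -/

/-- Transitivity on intervals fills the gaps: `[u, a]` is sent to `[u, f a]` and `[b, v]` to `[f b,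
v]`, and the pieces are glued to the identity outside `[u, v]`. -/
theorem exists_supp_eqOn {f : ℝ ≃o ℝ} (hf : f ∈ goldenPL) {u a b v : ℝ} (hu : u ∈ goldenRing)
    (ha : a ∈ goldenRing) (hb : b ∈ goldenRing) (hv : v ∈ goldenRing) (hab : a ≤ b) (hua : u < a)
    (hbv : b < v) (hua' : u < f a) (hbv' : f b < v) :
    ∃ h ∈ supp u v, ∀ x, a ≤ x → x ≤ b → h x = f x := by
  obtain ⟨e₁, he₁, h1, h2⟩ := exists_goldenPL_interval hu ha hu (goldenPL_apply_mem hf ha) hua hua'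
  obtain ⟨e₂, he₂, h3, h4⟩ := exists_goldenPL_interval hb hv (goldenPL_apply_mem hf hb) hv hbv hbv'
  have E1 : (1 : ℝ ≃o ℝ) u = e₁ u := h1.symm
  have E2 : glue 1 e₁ u E1 a = f a := by rw [glue_of_ge hua.le, h2]
  have E3 : glue (glue 1 e₁ u E1) f a E2 b = e₂ b := by rw [glue_of_ge hab, h3]
  have E4 : glue (glue (glue 1 e₁ u E1) f a E2) e₂ b E3 v = (1 : ℝ ≃o ℝ) v := by
    rw [glue_of_ge hbv.le, h4]; rfl
  refine ⟨glue (glue (glue (glue 1 e₁ u E1) f a E2) e₂ b E3) 1 v E4,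
    ⟨glue_mem (glue_mem (glue_mem (glue_mem (one_mem _) he₁ hu) hf ha) he₂ hb) (one_mem _) hv,
    ?_⟩, ?_⟩
  · rintro x (hx | hx)
    · rw [glue_of_le (by linarith), glue_of_le (by linarith), glue_of_le (by linarith),
        glue_of_le hx]
      rfl
    · rw [glue_of_ge hx]
      rfl
  · intro x hx hx'
    rw [glue_of_le (by linarith), glue_of_le (by linarith), glue_of_ge hx]

/-- Some element supported in `[u, v]` pushes `[a, b] ⊆ (u, v)` off itself to the right. -/
theorem exists_supp_push {u a b v : ℝ} (hu : u ∈ goldenRing) (ha : a ∈ goldenRing)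
    (hv : v ∈ goldenRing) (hua : u < a) (hab : a ≤ b) (hbv : b < v) :
    ∃ s ∈ supp u v, b < s a := by
  obtain ⟨c, hc, h1, h2⟩ := exists_goldenRing_between hbv
  obtain ⟨s, hs, h⟩ := exists_supp_eqOn (shift_mem (sub_mem hc ha)) hu ha ha hv le_rfl hua
    (hab.trans_lt hbv) (by simpa using hua.trans_le (hab.trans h1.le)) (by simpa using h2)
  refine ⟨s, hs, ?_⟩
  rw [h a le_rfl le_rfl]
  simpa using h1


/-- Local extension of elements of `goldenPL` by commutators of elements with small support. -/
theorem exists_commutator_eqOn {f : ℝ ≃o ℝ} (hf : f ∈ goldenPL) {u a b v : ℝ}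
    (hu : u ∈ goldenRing) (ha : a ∈ goldenRing) (hb : b ∈ goldenRing) (hv : v ∈ goldenRing)
    (hab : a ≤ b) (hua : u < a) (hbv : b < v) (hua' : u < f a) (hbv' : f b < v) :
    ∃ h ∈ ⁅supp u v, supp u v⁆, ∀ x, a ≤ x → x ≤ b → h x = f x := by
  obtain ⟨u₁, hu₁, h1, h2⟩ := exists_goldenRing_between (lt_min hua hua')
  obtain ⟨v₁, hv₁, h3, h4⟩ := exists_goldenRing_between (max_lt hbv hbv')
  rw [lt_min_iff] at h2
  rw [max_lt_iff] at h3
  obtain ⟨q, hq, hqf⟩ := exists_supp_eqOn hf hu₁ ha hb hv₁ hab h2.1 h3.1 h2.2 h3.2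
  -- Since `s` pushes the support of `q` beyond `v₁`, the second factor of `⁅q, s⁆ = q * (s * q⁻¹ *
  -- s⁻¹)` does nothing on `[a, b]`.
  obtain ⟨s, hs, hs'⟩ := exists_supp_push hu hu₁ hv h1 (by linarith : u₁ ≤ v₁) h4
  refine ⟨⁅q, s⁆, Subgroup.commutator_mem_commutator (supp_mono h1.le h4.le hq) hs, ?_⟩
  intro x hx hx'
  have h5 : ⁅q, s⁆ = q * (s * q⁻¹ * s⁻¹) := by
    rw [commutatorElement_def]; group
  rw [h5, RelIso.mul_apply, supp_apply_of_le (supp_conj (inv_mem hq) hs.1) (by linarith), hqf x hx hx']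

/-- Golden piecewise linear homeomorphisms with bounded support. -/
def bddSupp : Subgroup (ℝ ≃o ℝ) where
  carrier := {F | ∃ N : ℕ, F ∈ supp (-N) N}
  one_mem' := ⟨0, one_mem _⟩
  mul_mem' := by
    rintro F H ⟨N, hN⟩ ⟨K, hK⟩
    refine ⟨max N K, mul_mem (supp_mono ?_ ?_ hN) (supp_mono ?_ ?_ hK)⟩ <;> push_cast <;> simp
  inv_mem' := by
    rintro F ⟨N, hN⟩
    exact ⟨N, inv_mem hN⟩

theorem supp_le_bddSupp (a b : ℝ) : supp a b ≤ bddSupp := by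
  intro F hF
  obtain ⟨N, hN⟩ := exists_nat_ge (max |a| |b|)
  rw [max_le_iff] at hN
  exact ⟨N, supp_mono (neg_le.1 ((neg_le_abs a).trans hN.1)) ((le_abs_self b).trans hN.2) hF⟩

theorem bddSupp_le_goldenPL : bddSupp ≤ goldenPL := by
  rintro F ⟨N, hN⟩
  exact hN.1

theorem mem_bddSupp_of {F : ℝ ≃o ℝ} {a b : ℝ} (hF : F ∈ goldenPL)
    (h : ∀ x, x ≤ a ∨ b ≤ x → F x = x) : F ∈ bddSupp := supp_le_bddSupp a b ⟨hF, h⟩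

theorem exists_supp_of_mem_bddSupp {F : ℝ ≃o ℝ} (hF : F ∈ bddSupp) :
    ∃ a b : ℝ, a ∈ goldenRing ∧ b ∈ goldenRing ∧ a < b ∧ F ∈ supp a b := by
  obtain ⟨N, hN⟩ := hF
  refine ⟨-(N + 1 : ℕ), (N + 1 : ℕ), neg_mem (natCast_mem _ _), natCast_mem _ _, ?_,
    supp_mono ?_ ?_ hN⟩ <;> push_cast <;> linarith [(Nat.cast_nonneg N : (0 : ℝ) ≤ N)]

theorem exists_bddSupp_eqOn {f : ℝ ≃o ℝ} (hf : f ∈ goldenPL) {a b : ℝ}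
    (ha : a ∈ goldenRing) (hb : b ∈ goldenRing) (hab : a ≤ b) :
    ∃ h ∈ bddSupp, ∀ x, a ≤ x → x ≤ b → h x = f x := by
  obtain ⟨u, hu, -, hu'⟩ := exists_goldenRing_between (sub_one_lt (min a (f a)))
  obtain ⟨v, hv, hv', -⟩ := exists_goldenRing_between (lt_add_one (max b (f b)))
  rw [lt_min_iff] at hu'
  rw [max_lt_iff] at hv'
  obtain ⟨h, hh, hh'⟩ := exists_supp_eqOn hf hu ha hb hv hab hu'.1 hv'.1 hu'.2 hv'.2
  exact ⟨h, supp_le_bddSupp _ _ hh, hh'⟩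

theorem conj_mem_bddSupp {F k : ℝ ≃o ℝ} (hF : F ∈ bddSupp) (hk : k ∈ goldenPL) :
    k * F * k⁻¹ ∈ bddSupp := by
  obtain ⟨N, hN⟩ := hF
  exact supp_le_bddSupp _ _ (supp_conj hN hk)

theorem mem_commutator_supp_nat {F : ℝ ≃o ℝ} (hF : F ∈ ⁅bddSupp, bddSupp⁆) :
    ∃ N : ℕ, F ∈ ⁅supp (-N) N, supp (-N) N⁆ := by
  have mono : ∀ {N K : ℕ}, N ≤ K → supp (-(N : ℝ)) N ≤ supp (-(K : ℝ)) K := by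
    intro N K h
    have : (N : ℝ) ≤ K := by exact_mod_cast h
    exact supp_mono (neg_le_neg this) this
  rw [Subgroup.commutator_def] at hF
  induction hF using Subgroup.closure_induction with
  | mem x hx =>
    obtain ⟨F, ⟨N, hN⟩, H, ⟨K, hK⟩, rfl⟩ := hx
    exact ⟨max N K, Subgroup.commutator_mem_commutator (mono (le_max_left _ _) hN)
      (mono (le_max_right _ _) hK)⟩
  | one => exact ⟨0, one_mem _⟩
  | mul x y _ _ hx hy =>
    obtain ⟨N, hN⟩ := hx
    obtain ⟨K, hK⟩ := hy
    have h1 := mono (le_max_left N K)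
    have h2 := mono (le_max_right N K)
    exact ⟨max N K, mul_mem (Subgroup.commutator_mono h1 h1 hN)
      (Subgroup.commutator_mono h2 h2 hK)⟩
  | inv x _ hx =>
    obtain ⟨N, hN⟩ := hx
    exact ⟨N, inv_mem hN⟩

theorem conj_mem_commutator_of {K : Type*} [Group K] {S S' : Subgroup K} {q x : K}
    (h : ∀ y ∈ S, q * y * q⁻¹ ∈ S') (hx : x ∈ ⁅S, S⁆) : q * x * q⁻¹ ∈ ⁅S', S'⁆ := by
  have h1 : Subgroup.map (MulAut.conj q).toMonoidHom S ≤ S' := by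
    rintro _ ⟨y, hy, rfl⟩
    exact h y hy
  have h2 := Subgroup.commutator_mono h1 h1
  rw [← Subgroup.map_commutator] at h2
  exact h2 ⟨x, hx, rfl⟩

/-- An element of the commutator subgroup of `bddSupp` is a product of commutators of elements
supported in any neighbourhood of its support. -/
theorem mem_commutator_supp {F : ℝ ≃o ℝ} {u a b v : ℝ} (hF : F ∈ ⁅bddSupp, bddSupp⁆)
    (hF' : F ∈ supp a b) (hu : u ∈ goldenRing) (ha : a ∈ goldenRing) (hb : b ∈ goldenRing)
    (hv : v ∈ goldenRing) (hua : u < a) (hab : a ≤ b) (hbv : b < v) :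
    F ∈ ⁅supp u v, supp u v⁆ := by
  obtain ⟨N, hN⟩ := mem_commutator_supp_nat hF
  obtain ⟨K, hK⟩ := exists_nat_gt (max N (max (-a) b) : ℝ)
  rw [max_lt_iff, max_lt_iff] at hK
  have hKM : (K : ℝ) ∈ goldenRing := natCast_mem _ _
  -- The map `q` built below squeezes `[-K, K]` onto `[u, v]` and fixes `[a, b]` pointwise:
  -- conjugation by it fixes `F` but shrinks the supports in its commutator expression.
  obtain ⟨e₁, he₁, h1, h2⟩ := exists_goldenPL_interval (neg_mem hKM) ha hu ha (by linarith) hua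
  obtain ⟨e₂, he₂, h3, h4⟩ := exists_goldenPL_interval hb hKM hb hv (by linarith) hbv
  have E1 : e₁ a = (1 : ℝ ≃o ℝ) a := h2
  have E2 : glue e₁ 1 a E1 b = e₂ b := by rw [glue_of_ge hab, h3]; rfl
  set q := glue (glue e₁ 1 a E1) e₂ b E2 with hq
  have hqm : q ∈ goldenPL := glue_mem (glue_mem he₁ (one_mem _) ha) he₂ hb
  have h5 : q * F * q⁻¹ = F := by
    have := conj_eq_of_eqOn (k := q) (h := 1) hF' (fun x hx hx' => by
      rw [hq, glue_of_le hx', glue_of_ge hx])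
    simpa using this
  have h6 : q (-K) = u := by rw [hq, glue_of_le (by linarith), glue_of_le (by linarith), h1]
  have h7 : q K = v := by rw [hq, glue_of_ge (by linarith), h4]
  rw [← h5]
  refine conj_mem_commutator_of (S := supp (-N) N) (fun y hy => ?_) hN
  rw [← h6, ← h7]
  exact supp_conj (supp_mono (by linarith) (by linarith) hy) hqm

/-! ### Reduction to two commutators -/

/-- Displacement trick: the successive commutators making up `F` are placed in successive translates
of `S` under `h`. These translates commute, so all the copies fuse into a single commutator `⁅A,
B⁆`, and the discrepancy with `F` telescopes into a commutator with `h`. -/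
theorem eq_two_commutators {K : Type*} [Group K] {S L : Subgroup K} {h : K}
    (hS : ∀ x ∈ S, h * x * h⁻¹ ∈ L) (hL : ∀ x ∈ L, h * x * h⁻¹ ∈ L)
    (hSL : ∀ x ∈ S, ∀ y ∈ L, Commute x y) {F : K} (hF : F ∈ ⁅S, S⁆) :
    ∃ g ∈ S ⊔ L, ∃ A ∈ L, ∃ B ∈ L, F = ⁅g, h⁆ * ⁅A, B⁆ := by
  have hSL' : ∀ x ∈ S ⊔ L, h * x * h⁻¹ ∈ L := by
    intro x hx
    have h1 : S ⊔ L ≤ L.comap (MulAut.conj h).toMonoidHom := sup_le hS hL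
    exact h1 hx
  have hcS : ⁅S, S⁆ ≤ S := by
    rw [Subgroup.commutator_le]
    intro x hx y hy
    exact mul_mem (mul_mem (mul_mem hx hy) (inv_mem hx)) (inv_mem hy)
  have step : ∀ a ∈ S, ∀ b ∈ S, ∀ F₁ ∈ S, (∃ g ∈ S ⊔ L, ∃ A ∈ L, ∃ B ∈ L, F₁ = ⁅g, h⁆ * ⁅A, B⁆) →
      ∃ g ∈ S ⊔ L, ∃ A ∈ L, ∃ B ∈ L, ⁅a, b⁆ * F₁ = ⁅g, h⁆ * ⁅A, B⁆ := by
    rintro a ha b hb F₁ hF₁ ⟨g, hg, A, hA, B, hB, e⟩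
    have hab : ⁅a, b⁆ ∈ S := hcS (Subgroup.commutator_mem_commutator ha hb)
    -- The old data are shifted one place by `h`, and the new pair `a`, `b` enters the first free
    -- slot.
    refine ⟨⁅a, b⁆ * F₁ * (h * g * h⁻¹), mul_mem (Subgroup.mem_sup_left (mul_mem hab hF₁))
      (Subgroup.mem_sup_right (hSL' _ hg)), h * (a * A) * h⁻¹,
      hSL' _ (mul_mem (Subgroup.mem_sup_left ha) (Subgroup.mem_sup_right hA)), h * (b * B) * h⁻¹,
      hSL' _ (mul_mem (Subgroup.mem_sup_left hb) (Subgroup.mem_sup_right hB)), ?_⟩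
    have hABL : ⁅A, B⁆ ∈ L :=
      mul_mem (mul_mem (mul_mem hA hB) (inv_mem hA)) (inv_mem hB)
    have e1 : ⁅h * (a * A) * h⁻¹, h * (b * B) * h⁻¹⁆ = h * (⁅a, b⁆ * ⁅A, B⁆) * h⁻¹ := by
      have c1 : Commute A b := (hSL b hb A hA).symm
      have c2 : Commute A a⁻¹ := (hSL _ (inv_mem ha) A hA).symm
      have c4 : Commute B b⁻¹ := (hSL _ (inv_mem hb) B hB).symm
      have c5 : Commute (B * A⁻¹) a⁻¹ :=
        (hSL _ (inv_mem ha) _ (mul_mem hB (inv_mem hA))).symm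
      have c6 : Commute (A * B * A⁻¹ * B⁻¹) b⁻¹ := (hSL _ (inv_mem hb) _ hABL).symm
      have c7 : Commute (A * (B * A⁻¹)) a⁻¹ :=
        (hSL _ (inv_mem ha) _ (mul_mem hA (mul_mem hB (inv_mem hA)))).symm
      calc ⁅h * (a * A) * h⁻¹, h * (b * B) * h⁻¹⁆
          = h * (a * (A * b) * B * A⁻¹ * a⁻¹ * B⁻¹ * b⁻¹) * h⁻¹ := by
            rw [commutatorElement_def]; group
        _ = h * (a * b * ((A * (B * A⁻¹)) * a⁻¹) * B⁻¹ * b⁻¹) * h⁻¹ := by rw [c1.eq]; group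
        _ = h * (a * b * a⁻¹ * ((A * B * A⁻¹ * B⁻¹) * b⁻¹)) * h⁻¹ := by rw [c7.eq]; group
        _ = _ := by rw [c6.eq, commutatorElement_def, commutatorElement_def]; group
    have e2 : ⁅g, h⁆ = F₁ * ⁅A, B⁆⁻¹ := by rw [e]; group
    have c : Commute F₁⁻¹ ⁅A, B⁆ := hSL _ (inv_mem hF₁) _ hABL
    have e3 : ⁅⁅a, b⁆ * F₁ * (h * g * h⁻¹), h⁆ =
        ⁅a, b⁆ * F₁ * h * ⁅g, h⁆ * (⁅a, b⁆ * F₁)⁻¹ * h⁻¹ := by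
      rw [commutatorElement_def _ h, commutatorElement_def g h]; group
    rw [e1, e3, e2]
    have c' : F₁⁻¹ * ⁅A, B⁆ = ⁅A, B⁆ * F₁⁻¹ := c.eq
    calc ⁅a, b⁆ * F₁ = ⁅a, b⁆ * F₁ * h * F₁ * ⁅A, B⁆⁻¹ * (⁅A, B⁆ * F₁⁻¹) * h⁻¹ := by group
      _ = _ := by rw [← c']; group
  rw [Subgroup.commutator_def] at hF
  induction hF using Subgroup.closure_induction_left with
  | one => exact ⟨1, one_mem _, 1, one_mem _, 1, one_mem _, by simp⟩
  | mul_left x hx y hy ih =>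
    obtain ⟨a, ha, b, hb, rfl⟩ := hx
    rw [← Subgroup.commutator_def] at hy
    exact step a ha b hb y (hcS hy) ih
  | inv_mul_cancel x hx y hy ih =>
    obtain ⟨a, ha, b, hb, rfl⟩ := hx
    rw [← Subgroup.commutator_def] at hy
    rw [commutatorElement_inv]
    exact step b hb a ha y (hcS hy) ih

/-- With `⁅g, s⁆ = g * x` and `⁅h, s * s⁆ = h * y`, the factors `x` and `y` live on the images of
`[a, b]` under `s` and `s * s`. These are disjoint from each other and from `[a, b]` up to end
points, so only `g` and `h` interact. The point is that conjugators must later come from the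
commutator subgroup. -/
theorem commutatorElement_eq_of_push {u a b v : ℝ} {s g h : ℝ ≃o ℝ} (hs : s ∈ supp u v)
    (hsa : b ≤ s a) (hu : u ≤ a) (hv : b ≤ v) (hg : g ∈ supp a b) (hh : h ∈ supp a b) :
    ∃ g' ∈ ⁅supp u v, supp u v⁆, ∃ h' ∈ ⁅supp u v, supp u v⁆, ⁅g, h⁆ = ⁅g', h'⁆ := by
  have hle := supp_mono hu hv
  refine ⟨⁅g, s⁆, Subgroup.commutator_mem_commutator (hle hg) hs,
    ⁅h, s * s⁆, Subgroup.commutator_mem_commutator (hle hh) (mul_mem hs hs), ?_⟩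
  have k1 := supp_conj (inv_mem hg) hs.1
  have k2 := supp_conj (inv_mem hh) (mul_mem hs.1 hs.1)
  have hab' : s b ≤ (s * s) a := s.monotone hsa
  set x := s * g⁻¹ * s⁻¹
  set y := s * s * h⁻¹ * (s * s)⁻¹
  have hx : ⁅g, s⁆ = g * x := by simp only [commutatorElement_def, x, mul_assoc]
  have hy : ⁅h, s * s⁆ = h * y := by simp only [commutatorElement_def, y, mul_assoc]
  have c1 : Commute h x := supp_commute hsa hh k1
  have c2 : Commute x y := supp_commute hab' k1 k2
  have c3 : Commute g y := by
    rcases le_or_gt a b with h | h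
    · exact supp_commute (hsa.trans ((s.monotone h).trans hab')) hg k2
    · have : g = 1 := by
        ext z
        exact hg.2 z ((le_total z a).imp id (fun h' => h.le.trans h'))
      rw [this]
      exact Commute.one_left _
  have c5 : Commute (g * x) y := c3.mul_left c2
  rw [hx, hy]
  calc ⁅g, h⁆ = g * h * g⁻¹ * h⁻¹ := commutatorElement_def _ _
    _ = g * h * (x * x⁻¹) * g⁻¹ * h⁻¹ := by group
    _ = g * (x * h) * (y * y⁻¹) * x⁻¹ * g⁻¹ * h⁻¹ := by rw [← c1.eq]; group
    _ = (g * x) * h * y * (y⁻¹ * (g * x)⁻¹) * h⁻¹ := by group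
    _ = (g * x) * h * y * ((g * x)⁻¹ * y⁻¹) * h⁻¹ := by rw [c5.inv_inv.eq]
    _ = (g * x) * (h * y) * (g * x)⁻¹ * (h * y)⁻¹ := by group
    _ = _ := (commutatorElement_def _ _).symm

theorem exists_two_commutators {F : ℝ ≃o ℝ} {u a b v : ℝ} (hF : F ∈ ⁅bddSupp, bddSupp⁆)
    (hF' : F ∈ supp a b) (hu : u ∈ goldenRing) (ha : a ∈ goldenRing) (hb : b ∈ goldenRing)
    (hv : v ∈ goldenRing) (hua : u < a) (hab : a ≤ b) (hbv : b < v) :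
    ∃ g ∈ ⁅supp u v, supp u v⁆, ∃ h ∈ ⁅supp u v, supp u v⁆, ∃ A ∈ ⁅supp u v, supp u v⁆,
      ∃ B ∈ ⁅supp u v, supp u v⁆, F = ⁅g, h⁆ * ⁅A, B⁆ := by
  -- Three nested intervals: `[u₂, v₂]` carries the commutators of `F`, `[u₁, v₁]` leaves room for
  -- `h` and the shifted copies, and `[u, v]` leaves room for `s`.
  obtain ⟨u₁, hu₁, hu1, hu1'⟩ := exists_goldenRing_between hua
  obtain ⟨u₂, hu₂, hu2, hu2'⟩ := exists_goldenRing_between hu1'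
  obtain ⟨v₁, hv₁, hv1', hv1⟩ := exists_goldenRing_between hbv
  obtain ⟨v₂, hv₂, hv2', hv2⟩ := exists_goldenRing_between hv1'
  have hF₂ := mem_commutator_supp hF hF' hu₂ ha hb hv₂ hu2' hab hv2'
  obtain ⟨h, hh, hh'⟩ := exists_supp_push hu₁ hu₂ hv₁ hu2 (by linarith : u₂ ≤ v₂) hv2
  obtain ⟨s, hs, hs'⟩ := exists_supp_push hu hu₁ hv hu1 (by linarith : u₁ ≤ v₁) hv1
  have hhv : h v₁ = v₁ := supp_apply_of_ge hh le_rfl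
  have h2 : h v₂ ≤ v₁ := hhv ▸ h.monotone hv2.le
  have h3 : v₂ ≤ h v₂ := hh'.le.trans (h.monotone (by linarith))
  obtain ⟨g, hg, A, hA, B, hB, e⟩ := eq_two_commutators (S := supp u₂ v₂) (L := supp v₂ v₁)
    (h := h) (fun x hx => supp_mono hh'.le h2 (supp_conj hx hh.1))
    (fun x hx => supp_mono h3 hhv.le (supp_conj hx hh.1))
    (fun x hx y hy => supp_commute le_rfl hx hy) hF₂
  have hg1 : g ∈ supp u₁ v₁ := by
    refine (sup_le (supp_mono hu2.le hv2.le) (supp_mono ?_ le_rfl) :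
      supp u₂ v₂ ⊔ supp v₂ v₁ ≤ supp u₁ v₁) hg
    linarith
  have hL : supp v₂ v₁ ≤ supp u₁ v₁ := supp_mono (by linarith) le_rfl
  obtain ⟨g', hg', h', hh1', e1⟩ :=
    commutatorElement_eq_of_push hs hs'.le hu1.le hv1.le hg1 hh
  obtain ⟨A', hA', B', hB', e2⟩ :=
    commutatorElement_eq_of_push hs hs'.le hu1.le hv1.le (hL hA) (hL hB)
  exact ⟨g', hg', h', hh1', A', hA', B', hB', by rw [e, e1, e2]⟩

/-! ### The abelianization of `bddSupp` -/

open Classical in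
/-- The class of an element of `bddSupp` in the abelianization. -/
noncomputable def cls (F : ℝ ≃o ℝ) : Additive (Abelianization bddSupp) :=
  if h : F ∈ bddSupp then Additive.ofMul (Abelianization.of ⟨F, h⟩) else 0

theorem cls_mul {F H : ℝ ≃o ℝ} (hF : F ∈ bddSupp) (hH : H ∈ bddSupp) :
    cls (F * H) = cls F + cls H := by
  rw [cls, cls, cls, dif_pos hF, dif_pos hH, dif_pos (mul_mem hF hH), ← ofMul_mul, ← map_mul]
  rfl

theorem cls_one : cls 1 = 0 := by
  have h := cls_mul (one_mem bddSupp) (one_mem bddSupp)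
  rwa [mul_one, left_eq_add] at h

theorem cls_inv {F : ℝ ≃o ℝ} (hF : F ∈ bddSupp) : cls F⁻¹ = -cls F := by
  rw [eq_neg_iff_add_eq_zero, ← cls_mul (inv_mem hF) hF, inv_mul_cancel, cls_one]

/-- On the support of `F`, the conjugator agrees with an element of `bddSupp`. Invariance under
translations and scalings, which are not in `bddSupp`, is what makes `psi` well defined and
computable. -/
theorem cls_conj {F k : ℝ ≃o ℝ} (hF : F ∈ bddSupp) (hk : k ∈ goldenPL) :
    cls (k * F * k⁻¹) = cls F := by
  obtain ⟨a, b, ha, hb, hab, hF'⟩ := exists_supp_of_mem_bddSupp hF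
  obtain ⟨h, hh, hk'⟩ := exists_bddSupp_eqOn hk ha hb hab.le
  rw [conj_eq_of_eqOn (k := k) (h := h) hF' (fun x hx hx' => (hk' x hx hx').symm),
    cls_mul (mul_mem hh hF) (inv_mem hh), cls_mul hh hF, cls_inv hh]
  abel

theorem mem_commutator_of_cls_eq_zero {F : ℝ ≃o ℝ} (hF : F ∈ bddSupp) (h : cls F = 0) :
    F ∈ ⁅bddSupp, bddSupp⁆ := by
  rw [cls, dif_pos hF, ofMul_eq_zero, ← MonoidHom.mem_ker, Abelianization.ker_of] at h
  rw [← Subgroup.map_subtype_commutator]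
  exact ⟨_, h, rfl⟩

/-! ### Periodic maps -/

/-- The golden piecewise linear homeomorphisms commuting with the translation by `p`. -/
def periodic (p : ℝ) : Subgroup (ℝ ≃o ℝ) where
  carrier := {F | F ∈ goldenPL ∧ ∀ x, F (x + p) = F x + p}
  one_mem' := ⟨one_mem _, fun _ => rfl⟩
  mul_mem' := by
    rintro F H ⟨hF, hF'⟩ ⟨hH, hH'⟩
    refine ⟨mul_mem hF hH, fun x => ?_⟩
    rw [RelIso.mul_apply, RelIso.mul_apply, hH', hF']
  inv_mem' := by
    rintro F ⟨hF, hF'⟩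
    refine ⟨inv_mem hF, fun x => ?_⟩
    apply F.injective
    rw [hF', RelIso.apply_inv_self, RelIso.apply_inv_self]

/-- `m` agrees with `F` on `[y, y + p]`, with `c` to the left of `y` and with the translate of `c`
to the right of `y + p`. -/
structure Splice (p : ℝ) (F : ℝ ≃o ℝ) (y : ℝ) (c m : ℝ ≃o ℝ) : Prop where
  left_mem : c ∈ bddSupp
  mem : m ∈ bddSupp
  le : ∀ x, x ≤ y → m x = c x
  mid : ∀ x, y ≤ x → x ≤ y + p → m x = F x
  ge : ∀ x, y + p ≤ x → m x = c (x - p) + p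

theorem Splice.apply_eq {p : ℝ} {F : ℝ ≃o ℝ} {y : ℝ} {c m : ℝ ≃o ℝ} (h : Splice p F y c m)
    (hp : 0 ≤ p) : c y = F y := by
  rw [← h.le y le_rfl, h.mid y le_rfl (by linarith)]

theorem mem_bddSupp_of_splice {p : ℝ} {y : ℝ} {c m : ℝ ≃o ℝ} (hc : c ∈ bddSupp)
    (hm : m ∈ goldenPL) (le : ∀ x, x ≤ y → m x = c x)
    (ge : ∀ x, y + p ≤ x → m x = c (x - p) + p) : m ∈ bddSupp := by
  obtain ⟨a, b, -, -, -, hc'⟩ := exists_supp_of_mem_bddSupp hc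
  refine mem_bddSupp_of (a := min a y) (b := max (b + p) (y + p)) hm fun x hx => ?_
  rcases hx with hx | hx
  · rw [le_min_iff] at hx
    rw [le x hx.2, supp_apply_of_le hc' hx.1]
  · rw [max_le_iff] at hx
    rw [ge x hx.2, supp_apply_of_ge hc' (by linarith)]
    ring

theorem exists_splice {p : ℝ} (hp : 0 ≤ p) (hpM : p ∈ goldenRing) {F : ℝ ≃o ℝ}
    (hF : F ∈ periodic p) {y : ℝ} (hy : y ∈ goldenRing) {c : ℝ ≃o ℝ} (hc : c ∈ bddSupp)
    (h : c y = F y) : ∃ m, Splice p F y c m := by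
  have E : glue c F y h (y + p) = (shift p * c * (shift p)⁻¹) (y + p) := by
    rw [glue_of_ge (by linarith), hF.2]
    simp [h]
  have hle : ∀ x, x ≤ y → glue (glue c F y h) (shift p * c * (shift p)⁻¹) (y + p) E x = c x := by
    intro x hx
    rw [glue_of_le (by linarith), glue_of_le hx]
  have hge : ∀ x, y + p ≤ x →
      glue (glue c F y h) (shift p * c * (shift p)⁻¹) (y + p) E x = c (x - p) + p := by
    intro x hx
    rw [glue_of_ge hx]
    simp
  have hcG := bddSupp_le_goldenPL hc
  refine ⟨_, hc, mem_bddSupp_of_splice hc (glue_mem (glue_mem hcG hF.1 hy) (mul_mem (mul_mem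
    (shift_mem hpM) hcG) (inv_mem (shift_mem hpM))) (add_mem hy hpM)) hle hge, hle, ?_, hge⟩
  intro x hx hx'
  rw [glue_of_le hx', glue_of_ge hx]

/-- Two choices of `c` differ by some `u` fixing `y`, which splits as `l * r` with `l` acting left
and `r` right of `y`. Passing from `m` to `m'` inserts `l` unchanged and `r` translated by `p`, so
the class changes by that of `u`, exactly as for `c`. -/
theorem Splice.cls_eq {p : ℝ} (hp : 0 ≤ p) (hpM : p ∈ goldenRing) {F : ℝ ≃o ℝ} {y : ℝ}
    (hy : y ∈ goldenRing) {c m c' m' : ℝ ≃o ℝ} (h : Splice p F y c m) (h' : Splice p F y c' m') :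
    cls m - cls c = cls m' - cls c' := by
  obtain ⟨u, hu_def⟩ : ∃ u, u = c⁻¹ * c' := ⟨_, rfl⟩
  have huy : u y = y := by
    rw [hu_def, RelIso.mul_apply, h'.apply_eq hp, ← h.apply_eq hp, RelIso.inv_apply_self]
  have hu : u ∈ bddSupp := hu_def ▸ mul_mem (inv_mem h.left_mem) h'.left_mem
  have huG := bddSupp_le_goldenPL hu
  have hcu : c' = c * u := by rw [hu_def, mul_inv_cancel_left]
  have E1 : u y = (1 : ℝ ≃o ℝ) y := huy
  have E2 : (1 : ℝ ≃o ℝ) y = u y := huy.symm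
  obtain ⟨a, b, -, -, -, hab⟩ := exists_supp_of_mem_bddSupp hu
  set l := glue u 1 y E1
  set r := glue 1 u y E2
  have hl : l ∈ bddSupp := by
    refine mem_bddSupp_of (a := a) (b := b) (glue_mem huG (one_mem _) hy) fun x hx => ?_
    rcases le_total x y with hxy | hxy
    · rw [glue_of_le hxy, hab.2 x hx]
    · rw [glue_of_ge hxy]; rfl
  have hr : r ∈ bddSupp := by
    refine mem_bddSupp_of (a := a) (b := b) (glue_mem (one_mem _) huG hy) fun x hx => ?_
    rcases le_total x y with hxy | hxy
    · rw [glue_of_le hxy]; rfl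
    · rw [glue_of_ge hxy, hab.2 x hx]
  have hlr : u = l * r := by
    ext x
    rw [RelIso.mul_apply]
    rcases le_total x y with hxy | hxy
    · have h1 : r x = x := glue_of_le hxy
      have h2 : l x = u x := glue_of_le hxy
      rw [h1, h2]
    · have h1 : r x = u x := glue_of_ge hxy
      have h2 : l (u x) = u x := glue_of_ge (huy ▸ u.monotone hxy)
      rw [h1, h2]
  have hm : m' = m * (l * (shift p * r * (shift p)⁻¹)) := by
    ext x
    have e0 : (m * (l * (shift p * r * (shift p)⁻¹))) x = m (l (r (x - p) + p)) := by
      simp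
    rw [e0]
    rcases le_total x y with hxy | hxy
    · have h1 : r (x - p) = x - p := glue_of_le (by linarith)
      have h2 : l x = u x := glue_of_le hxy
      have h3 : u x ≤ y := huy ▸ u.monotone hxy
      rw [h1, sub_add_cancel, h2, h.le _ h3, h'.le x hxy, hcu, RelIso.mul_apply]
    rcases le_total x (y + p) with hxp | hxp
    · have h1 : r (x - p) = x - p := glue_of_le (by linarith)
      have h2 : l x = x := glue_of_ge hxy
      rw [h1, sub_add_cancel, h2, h.mid x hxy hxp, h'.mid x hxy hxp]
    · have h1 : r (x - p) = u (x - p) := glue_of_ge (by linarith)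
      have h3 : y ≤ u (x - p) := huy ▸ u.monotone (by linarith)
      have h2 : l (u (x - p) + p) = u (x - p) + p := glue_of_ge (by linarith)
      rw [h1, h2, h'.ge x hxp, h.ge _ (by linarith), hcu, RelIso.mul_apply, add_sub_cancel_right]
  have hr' : shift p * r * (shift p)⁻¹ ∈ bddSupp := conj_mem_bddSupp hr (shift_mem hpM)
  rw [hm, hcu, cls_mul h.mem (mul_mem hl hr'), cls_mul hl hr', cls_conj hr (shift_mem hpM),
    cls_mul h.left_mem hu, hlr, cls_mul hl hr]
  abel

/-- If `d` follows `F` on all of `[y, z]`, then by periodicity the splice of `d` at `y` is also a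
splice at `z`. -/
theorem Splice.cls_eq_of_base_le {p : ℝ} (hp : 0 ≤ p) (hpM : p ∈ goldenRing) {F : ℝ ≃o ℝ}
    (hF : F ∈ periodic p) {y z : ℝ}
    (hy : y ∈ goldenRing) (hz : z ∈ goldenRing) (hyz : y ≤ z) {c m c' m' : ℝ ≃o ℝ}
    (h : Splice p F y c m) (h' : Splice p F z c' m') : cls m - cls c = cls m' - cls c' := by
  obtain ⟨d, hd, hdF⟩ := exists_bddSupp_eqOn hF.1 hy hz hyz
  obtain ⟨k, hk⟩ := exists_splice hp hpM hF hy hd (hdF y le_rfl hyz)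
  have hk' : Splice p F z d k := by
    refine ⟨hd, hk.mem, fun x hx => ?_, fun x hx hx' => ?_, fun x hx => hk.ge x (by linarith)⟩
    · rcases le_total x y with hxy | hxy
      · exact hk.le x hxy
      rw [hdF x hxy hx]
      rcases le_total x (y + p) with hxp | hxp
      · exact hk.mid x hxy hxp
      · rw [hk.ge x hxp, hdF _ (by linarith) (by linarith), ← hF.2, sub_add_cancel]
    · rcases le_total x (y + p) with hxp | hxp
      · exact hk.mid x (by linarith) hxp
      · rw [hk.ge x hxp, hdF _ (by linarith) (by linarith), ← hF.2, sub_add_cancel]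
  rw [h.cls_eq hp hpM hy hk, hk'.cls_eq hp hpM hz h']

theorem Splice.cls_eq_of_base {p : ℝ} (hp : 0 ≤ p) (hpM : p ∈ goldenRing) {F : ℝ ≃o ℝ}
    (hF : F ∈ periodic p) {y z : ℝ}
    (hy : y ∈ goldenRing) (hz : z ∈ goldenRing) {c m c' m' : ℝ ≃o ℝ}
    (h : Splice p F y c m) (h' : Splice p F z c' m') : cls m - cls c = cls m' - cls c' := by
  rcases le_total y z with hyz | hyz
  · exact h.cls_eq_of_base_le hp hpM hF hy hz hyz h'
  · exact (h'.cls_eq_of_base_le hp hpM hF hz hy hyz h).symm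

open Classical in
/-- The homomorphism from `periodic p` to the abelianization of `bddSupp` that extends the class
of the elements supported in a fundamental interval. -/
noncomputable def psi (p : ℝ) (F : ℝ ≃o ℝ) : Additive (Abelianization bddSupp) :=
  if h : ∃ q : (ℝ ≃o ℝ) × (ℝ ≃o ℝ), Splice p F 0 q.1 q.2 then cls h.choose.2 - cls h.choose.1
  else 0

theorem exists_splice_base {p : ℝ} (hp : 0 ≤ p) (hpM : p ∈ goldenRing) {F : ℝ ≃o ℝ}
    (hF : F ∈ periodic p) {y : ℝ} (hy : y ∈ goldenRing) : ∃ c m, Splice p F y c m := by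
  obtain ⟨d, hd, hdF⟩ := exists_bddSupp_eqOn hF.1 hy hy le_rfl
  exact ⟨d, exists_splice hp hpM hF hy hd (hdF y le_rfl le_rfl)⟩

theorem Splice.psi_eq {p : ℝ} (hp : 0 ≤ p) (hpM : p ∈ goldenRing) {F : ℝ ≃o ℝ}
    (hF : F ∈ periodic p) {y : ℝ} (hy : y ∈ goldenRing) {c m : ℝ ≃o ℝ} (h : Splice p F y c m) :
    psi p F = cls m - cls c := by
  obtain ⟨d, k, hk⟩ := exists_splice_base hp hpM hF (zero_mem _)
  have hex : ∃ q : (ℝ ≃o ℝ) × (ℝ ≃o ℝ), Splice p F 0 q.1 q.2 := ⟨(d, k), hk⟩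
  rw [psi, dif_pos hex]
  exact hex.choose_spec.cls_eq_of_base hp hpM hF (zero_mem _) hy h

/-- A splice of `H` at `0` composes with a splice of `F` at `H 0`; independence of the base point
then applies. -/
theorem psi_mul {p : ℝ} (hp : 0 ≤ p) (hpM : p ∈ goldenRing) {F H : ℝ ≃o ℝ}
    (hF : F ∈ periodic p) (hH : H ∈ periodic p) : psi p (F * H) = psi p F + psi p H := by
  obtain ⟨d, k, hk⟩ := exists_splice_base hp hpM hH (zero_mem _)
  have h0 : H 0 ∈ goldenRing := goldenPL_apply_mem hH.1 (zero_mem _)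
  obtain ⟨c, m, hm⟩ := exists_splice_base hp hpM hF h0
  have hHp : H (0 + p) = H 0 + p := hH.2 0
  have hd0 := hk.apply_eq hp
  have hs : Splice p (F * H) 0 (c * d) (m * k) := by
    refine ⟨mul_mem hm.left_mem hk.left_mem, mul_mem hm.mem hk.mem, fun x hx => ?_,
      fun x hx hx' => ?_, fun x hx => ?_⟩
    · rw [RelIso.mul_apply, RelIso.mul_apply, hk.le x hx, hm.le]
      exact hd0 ▸ d.monotone hx
    · rw [RelIso.mul_apply, RelIso.mul_apply, hk.mid x hx hx', hm.mid]
      · exact H.monotone hx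
      · exact hHp ▸ H.monotone hx'
    · have h1 : H 0 ≤ d (x - p) := hd0 ▸ d.monotone (by linarith)
      rw [RelIso.mul_apply, RelIso.mul_apply, hk.ge x hx, hm.ge _ (by linarith),
        add_sub_cancel_right]
  rw [hs.psi_eq hp hpM (mul_mem hF hH) (zero_mem _), hm.psi_eq hp hpM hF h0,
    hk.psi_eq hp hpM hH (zero_mem _), cls_mul hm.mem hk.mem, cls_mul hm.left_mem hk.left_mem]
  abel

theorem psi_inv {p : ℝ} (hp : 0 ≤ p) (hpM : p ∈ goldenRing) {F : ℝ ≃o ℝ}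
    (hF : F ∈ periodic p) : psi p F⁻¹ = -psi p F := by
  have h1 : psi p 1 = 0 := by
    have := psi_mul hp hpM (one_mem (periodic p)) (one_mem (periodic p))
    rwa [mul_one, left_eq_add] at this
  rw [eq_neg_iff_add_eq_zero, ← psi_mul hp hpM (inv_mem hF) hF, inv_mul_cancel, h1]

theorem psi_eq_zero_of_mem_commutator {p : ℝ} (hp : 0 ≤ p) (hpM : p ∈ goldenRing) {F : ℝ ≃o ℝ}
    (hF : F ∈ ⁅periodic p, periodic p⁆) : psi p F = 0 := by
  have h1 : ⁅periodic p, periodic p⁆ ≤ periodic p := by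
    rw [Subgroup.commutator_le]
    intro x hx y hy
    exact mul_mem (mul_mem (mul_mem hx hy) (inv_mem hx)) (inv_mem hy)
  rw [Subgroup.commutator_def] at hF
  induction hF using Subgroup.closure_induction with
  | mem x hx =>
    obtain ⟨F, hF, H, hH, rfl⟩ := hx
    rw [commutatorElement_def, psi_mul hp hpM (mul_mem (mul_mem hF hH) (inv_mem hF)) (inv_mem hH),
      psi_mul hp hpM (mul_mem hF hH) (inv_mem hF), psi_mul hp hpM hF hH, psi_inv hp hpM hF,
      psi_inv hp hpM hH]
    abel
  | one =>
    have := psi_mul hp hpM (one_mem (periodic p)) (one_mem (periodic p))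
    rwa [mul_one, left_eq_add] at this
  | mul x y hx hy ihx ihy =>
    rw [← Subgroup.commutator_def] at hx hy
    rw [psi_mul hp hpM (h1 hx) (h1 hy), ihx, ihy, add_zero]
  | inv x hx ih =>
    rw [← Subgroup.commutator_def] at hx
    rw [psi_inv hp hpM (h1 hx), ih, neg_zero]

/-! ### Translations -/

theorem shift_mem_periodic {t : ℝ} (ht : t ∈ goldenRing) (p : ℝ) : shift t ∈ periodic p :=
  ⟨shift_mem ht, fun x => by simp only [shift_apply]; ring⟩

theorem psi_shift_add {p s t : ℝ} (hp : 0 ≤ p) (hpM : p ∈ goldenRing) (hs : s ∈ goldenRing)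
    (ht : t ∈ goldenRing) : psi p (shift (s + t)) = psi p (shift s) + psi p (shift t) := by
  have h : shift (s + t) = shift s * shift t := by
    ext x
    simp only [RelIso.mul_apply, shift_apply]
    ring
  rw [h, psi_mul hp hpM (shift_mem_periodic hs p) (shift_mem_periodic ht p)]

/-- The splice of length `q`, translated by `p`, is appended to the splice of length `p`. The factor
`c'⁻¹` removes the tail counted twice. -/
theorem psi_add_shift {p q t : ℝ} (hp : 0 ≤ p) (hpM : p ∈ goldenRing) (hq : 0 ≤ q)
    (hqM : q ∈ goldenRing) (ht : t ∈ goldenRing) :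
    psi (p + q) (shift t) = psi p (shift t) + psi q (shift t) := by
  obtain ⟨c, hc, hct⟩ :=
    exists_bddSupp_eqOn (shift_mem ht) (zero_mem goldenRing) (zero_mem _) le_rfl
  have hc0 := hct 0 le_rfl le_rfl
  obtain ⟨m, hm⟩ :=
    exists_splice hp hpM (shift_mem_periodic ht p) (zero_mem _) hc hc0
  obtain ⟨k, hk⟩ :=
    exists_splice hq hqM (shift_mem_periodic ht q) (zero_mem _) hc hc0
  have hpS := shift_mem hpM
  set c' := shift p * c * (shift p)⁻¹ with hc'
  set k' := shift p * k * (shift p)⁻¹ with hk'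
  have hc'm : c' ∈ bddSupp := conj_mem_bddSupp hc hpS
  have hk'm : k' ∈ bddSupp := conj_mem_bddSupp hk.mem hpS
  have e : ∀ x, c' x = c (x - p) + p := fun x => by simp [hc']
  have e' : ∀ x, k' x = k (x - p) + p := fun x => by simp [hk']
  have e2 : ∀ x, c' ((c'⁻¹ * k') x) = k' x := fun x => by
    rw [← RelIso.mul_apply, mul_inv_cancel_left]
  have e1 : ∀ x, x ≤ p → (c'⁻¹ * k') x = x := by
    intro x hx
    apply c'.injective
    rw [e2, e, e', hk.le _ (by linarith)]
  have hcp : (c'⁻¹ * k') p = p := e1 p le_rfl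
  have hs : Splice (p + q) (shift t) 0 c (m * (c'⁻¹ * k')) := by
    refine ⟨hc, mul_mem hm.mem (mul_mem (inv_mem hc'm) hk'm), fun x hx => ?_, fun x hx hx' => ?_,
      fun x hx => ?_⟩
    · rw [RelIso.mul_apply, e1 x (by linarith), hm.le x hx]
    · rcases le_total x p with hxp | hxp
      · rw [RelIso.mul_apply, e1 x hxp, hm.mid x hx (by linarith)]
      · have h1 : p ≤ (c'⁻¹ * k') x := by
          rw [← hcp]
          exact (c'⁻¹ * k').monotone hxp
        rw [RelIso.mul_apply, hm.ge _ (by linarith), ← e, e2, e', hk.mid _ (by linarith) (by linarith)]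
        simp only [shift_apply]
        ring
    · have h1 : p ≤ (c'⁻¹ * k') x := by
        conv_lhs => rw [← hcp]
        exact (c'⁻¹ * k').monotone (by linarith)
      rw [RelIso.mul_apply, hm.ge _ (by linarith), ← e, e2, e', hk.ge _ (by linarith), sub_sub]
      ring
  rw [hs.psi_eq (add_nonneg hp hq) (add_mem hpM hqM) (shift_mem_periodic ht _) (zero_mem _),
    hm.psi_eq hp hpM (shift_mem_periodic ht _) (zero_mem _),
    hk.psi_eq hq hqM (shift_mem_periodic ht _) (zero_mem _),
    cls_mul hm.mem (mul_mem (inv_mem hc'm) hk'm), cls_mul (inv_mem hc'm) hk'm, cls_inv hc'm,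
    hc', hk', cls_conj hc hpS, cls_conj hk.mem hpS]
  abel

theorem psi_scale_shift {p t : ℝ} (hp : 0 ≤ p) (hpM : p ∈ goldenRing) (ht : t ∈ goldenRing) :
    psi (smallGolden * p) (shift (smallGolden * t)) = psi p (shift t) := by
  obtain ⟨c, m, hm⟩ := exists_splice_base hp hpM (shift_mem_periodic ht p) (zero_mem _)
  have hτ := smallGolden_pos
  have hτ' := hτ.ne'
  have hA := goldenAffine_mem 1 (zero_mem goldenRing)
  set A := goldenAffine 1 0
  have eA : ∀ x, A x = smallGolden * x := fun x => by simp [A, goldenAffine_apply]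
  have eA' : ∀ x, A⁻¹ x = x / smallGolden := fun x => by
    apply A.injective
    rw [RelIso.apply_inv_self, eA]
    field_simp
  have hs : Splice (smallGolden * p) (shift (smallGolden * t)) 0 (A * c * A⁻¹) (A * m * A⁻¹) := by
    refine ⟨conj_mem_bddSupp hm.left_mem hA, conj_mem_bddSupp hm.mem hA, fun x hx => ?_,
      fun x hx hx' => ?_, fun x hx => ?_⟩ <;>
    simp only [RelIso.mul_apply, eA, eA', shift_apply]
    · rw [hm.le _ (div_nonpos_of_nonpos_of_nonneg hx hτ.le)]
    · rw [hm.mid _ (by positivity) (by rw [div_le_iff₀ hτ]; linarith), shift_apply]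
      field_simp
    · rw [hm.ge _ (by rw [le_div_iff₀ hτ]; linarith), sub_div, mul_div_cancel_left₀ _ hτ']
      ring
  rw [hs.psi_eq (mul_nonneg hτ.le hp) (mul_mem smallGolden_mem hpM)
    (shift_mem_periodic (mul_mem smallGolden_mem ht) _) (zero_mem _),
    hm.psi_eq hp hpM (shift_mem_periodic ht _) (zero_mem _), cls_conj hm.left_mem hA,
    cls_conj hm.mem hA]

/-- Write `a(p, t)` for `psi p (shift t)`. It is additive in `p ≥ 0` and in `t`, and `a(τp, τt) =
a(p, t)`. Splitting `1 = τ + τ²` gives `a(1, τ) = a(1, 1) + a(τ, 1)` and `a(τ, 1) = a(1, 1) + a(1,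
τ)`, whence `2 a(1, 1) = 0`. -/
theorem psi_one_shift_two : psi 1 (shift 2) = 0 := by
  have hτ := smallGolden_pos
  have hτM := smallGolden_mem
  have h1M : (1 : ℝ) ∈ goldenRing := one_mem _
  have hττ : smallGolden + smallGolden * smallGolden = 1 := by
    linear_combination smallGolden_sq
  have hM2 := mul_mem hτM hτM
  have a1 := psi_scale_shift zero_le_one h1M h1M
  have a2 := psi_scale_shift zero_le_one h1M hτM
  have a3 := psi_scale_shift hτ.le hτM h1M
  have a4 := psi_shift_add hτ.le hτM hτM hM2
  have a5 := psi_add_shift hτ.le hτM (mul_pos hτ hτ).le hM2 hτM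
  rw [hττ] at a4 a5
  rw [mul_one] at a1 a2 a3
  rw [a1, a2] at a4
  rw [a1, a3, a4] at a5
  have a6 := psi_shift_add zero_le_one h1M h1M h1M
  rw [one_add_one_eq_two] at a6
  rw [a6]
  rw [← add_assoc, right_eq_add] at a5
  exact a5

/-! ### Periodic extension -/

theorem periodic_apply_add_int {F : ℝ ≃o ℝ} (hF : F ∈ periodic 1) (x : ℝ) (n : ℤ) :
    F (x + n) = F x + n := by
  induction n using Int.induction_on with
  | zero => simp
  | succ n ih =>
    have h := hF.2 (x + (n : ℤ))
    rw [ih] at h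
    push_cast at h ⊢
    rw [← add_assoc, h, add_assoc]
  | pred n ih =>
    have h := hF.2 (x + ((-n - 1 : ℤ) : ℝ))
    have e : x + ((-n - 1 : ℤ) : ℝ) + 1 = x + ((-n : ℤ) : ℝ) := by push_cast; ring
    rw [e, ih] at h
    push_cast at h ⊢
    linarith

theorem periodic_apply_sub_int {F : ℝ ≃o ℝ} (hF : F ∈ periodic 1) (x : ℝ) (n : ℤ) :
    F (x - n) = F x - n := by
  have h := periodic_apply_add_int hF (x - n) n
  rw [sub_add_cancel] at h
  linarith

theorem exists_int_sub_mem (r x : ℝ) : ∃ n : ℤ, r ≤ x - n ∧ x - n < r + 1 :=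
  ⟨⌊x - r⌋, by linarith [Int.floor_le (x - r)], by linarith [Int.lt_floor_add_one (x - r)]⟩

theorem periodic_ext {F H : ℝ ≃o ℝ} (hF : F ∈ periodic 1) (hH : H ∈ periodic 1) {r : ℝ}
    (h : ∀ x, r ≤ x → x ≤ r + 1 → F x = H x) : F = H := by
  ext x
  obtain ⟨n, h1, h2⟩ := exists_int_sub_mem r x
  have h3 := h _ h1 h2.le
  rw [periodic_apply_sub_int hF, periodic_apply_sub_int hH] at h3
  linarith

theorem exists_periodic_eqOn {r : ℝ} (hr : r ∈ goldenRing) {h : ℝ ≃o ℝ}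
    (hh : h ∈ supp r (r + 1)) : ∃ F ∈ periodic 1, ∀ x, r ≤ x → x ≤ r + 1 → F x = h x := by
  have h0 : h r = r := supp_apply_of_le hh le_rfl
  have h1 : h (r + 1) = r + 1 := supp_apply_of_ge hh le_rfl
  obtain ⟨f, hf⟩ : ∃ f : ℝ → ℝ, ∀ x, f x = h (x - ⌊x - r⌋) + ⌊x - r⌋ := ⟨_, fun _ => rfl⟩
  -- The formula holds on the closed interval because `h` fixes both `r` and `r + 1`, so adjacent
  -- pieces agree.
  have val : ∀ (n : ℤ) (x : ℝ), r + n ≤ x → x ≤ r + n + 1 → f x = h (x - n) + n := by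
    intro n x hx hx'
    rcases hx'.lt_or_eq with hlt | rfl
    · have : ⌊x - r⌋ = n := Int.floor_eq_iff.2 ⟨by linarith, by linarith⟩
      rw [hf, this]
    · have h2 : ⌊r + n + 1 - r⌋ = n + 1 := by
        rw [show r + n + 1 - r = ((n + 1 : ℤ) : ℝ) by push_cast; ring, Int.floor_intCast]
      have h3 : r + n + 1 - ((n + 1 : ℤ) : ℝ) = r := by push_cast; ring
      have h4 : r + n + 1 - n = r + 1 := by ring
      rw [hf, h2, h3, h4, h0, h1]
      push_cast
      ring
  have bd : ∀ (n : ℤ) (x : ℝ), r + n ≤ x → x < r + n + 1 → r + n ≤ f x ∧ f x < r + n + 1 := by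
    intro n x hx hx'
    rw [val n x hx hx'.le]
    have h2 : h r ≤ h (x - n) := h.monotone (by linarith)
    have h3 : h (x - n) < h (r + 1) := h.strictMono (by linarith)
    constructor <;> linarith
  have mono : StrictMono f := by
    intro x y hxy
    obtain ⟨n, hn, hn'⟩ := exists_int_sub_mem r x
    obtain ⟨m, hm, hm'⟩ := exists_int_sub_mem r y
    rcases lt_trichotomy n m with hlt | rfl | hlt
    · have h2 := (bd n x (by linarith) (by linarith)).2
      have h3 := (bd m y (by linarith) (by linarith)).1
      have h4 : (n : ℝ) + 1 ≤ m := by exact_mod_cast hlt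
      linarith
    · rw [val n x (by linarith) (by linarith), val n y (by linarith) (by linarith)]
      have := h.strictMono (show x - n < y - n by linarith)
      linarith
    · have h4 : (m : ℝ) + 1 ≤ n := by exact_mod_cast hlt
      linarith
  have surj : Function.Surjective f := by
    intro y
    obtain ⟨n, hn, hn'⟩ := exists_int_sub_mem r y
    have h2 : r ≤ h⁻¹ (y - n) := by
      rw [← h.le_iff_le, RelIso.apply_inv_self, h0]
      exact hn
    have h3 : h⁻¹ (y - n) ≤ r + 1 := by
      rw [← h.le_iff_le, RelIso.apply_inv_self, h1]
      exact hn'.le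
    refine ⟨h⁻¹ (y - n) + n, ?_⟩
    rw [val n _ (by linarith) (by linarith), add_sub_cancel_right, RelIso.apply_inv_self,
      sub_add_cancel]
  refine ⟨mono.orderIsoOfSurjective f surj, ⟨⟨fun x => ?_, fun x => ?_⟩, fun x => ?_⟩,
    fun x hx hx' => ?_⟩
  · change f x ∈ goldenRing ↔ _
    rw [hf]
    constructor
    · intro h2
      have h3 := sub_mem h2 (intCast_mem goldenRing ⌊x - r⌋)
      rw [add_sub_cancel_right, hh.1.1] at h3
      simpa using add_mem h3 (intCast_mem goldenRing ⌊x - r⌋)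
    · intro h2
      exact add_mem (goldenPL_apply_mem hh.1 (sub_mem h2 (intCast_mem _ _))) (intCast_mem _ _)
  · obtain ⟨n, hn, hn'⟩ := exists_int_sub_mem r x
    have hs : ∀ k : ℤ, shift (k : ℝ) * h * (shift (k : ℝ))⁻¹ ∈ goldenPL := fun k =>
      mul_mem (mul_mem (shift_mem (intCast_mem _ k)) hh.1)
        (inv_mem (shift_mem (intCast_mem _ k)))
    -- Around `r + n` the extension is the gluing of two adjacent translates of `h`, so the local
    -- condition follows from `glue_mem`.
    have E : (shift ((n - 1 : ℤ) : ℝ) * h * (shift ((n - 1 : ℤ) : ℝ))⁻¹) (r + n) =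
        (shift (n : ℝ) * h * (shift (n : ℝ))⁻¹) (r + n) := by
      have h2 : r + n - ((n - 1 : ℤ) : ℝ) = r + 1 := by push_cast; ring
      simp only [RelIso.mul_apply, shift_inv_apply, shift_apply, h2, h1, add_sub_cancel_right, h0]
      push_cast
      ring
    have hg : glue _ _ (r + n) E ∈ goldenPL :=
      glue_mem (hs _) (hs _) (add_mem hr (intCast_mem _ _))
    refine (hg.2 x).congr ?_
    filter_upwards [Ioo_mem_nhds (show r + n - 1 < x by linarith)
      (show x < r + n + 1 by linarith)] with z hz
    change _ = f z
    rcases le_total z (r + n) with hz' | hz'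
    · rw [glue_of_le hz', val (n - 1) z (by push_cast; linarith [hz.1]) (by push_cast; linarith)]
      simp
    · rw [glue_of_ge hz', val n z hz' hz.2.le]
      simp
  · change f (x + 1) = f x + 1
    have h2 : ⌊x + 1 - r⌋ = ⌊x - r⌋ + 1 := by
      rw [show x + 1 - r = x - r + 1 by ring, Int.floor_add_one]
    rw [hf, hf, h2]
    push_cast
    rw [add_sub_add_right_eq_sub, add_assoc]
  · change f x = h x
    rw [val 0 x (by simpa using hx) (by simpa using hx')]
    simp

open Classical in
/-- The periodic extension of a homeomorphism supported in `[r, r + 1]`. -/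
noncomputable def periodize (r : ℝ) (h : ℝ ≃o ℝ) : ℝ ≃o ℝ :=
  if H : ∃ F ∈ periodic 1, ∀ x, r ≤ x → x ≤ r + 1 → F x = h x then H.choose else 1

section periodize
variable {r : ℝ} {h k : ℝ ≃o ℝ}

theorem periodize_mem (r : ℝ) (h : ℝ ≃o ℝ) : periodize r h ∈ periodic 1 := by
  rw [periodize]
  split_ifs with H
  · exact H.choose_spec.1
  · exact one_mem _

theorem periodize_apply (hr : r ∈ goldenRing) (hh : h ∈ supp r (r + 1)) {x : ℝ} (hx : r ≤ x)
    (hx' : x ≤ r + 1) : periodize r h x = h x := by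
  rw [periodize, dif_pos (exists_periodic_eqOn hr hh)]
  exact (exists_periodic_eqOn hr hh).choose_spec.2 x hx hx'

theorem periodize_mul (hr : r ∈ goldenRing) (hh : h ∈ supp r (r + 1)) (hk : k ∈ supp r (r + 1)) :
    periodize r (h * k) = periodize r h * periodize r k := by
  refine periodic_ext (periodize_mem _ _) (mul_mem (periodize_mem _ _) (periodize_mem _ _))
    (r := r) fun x hx hx' => ?_
  have h0 : k r = r := supp_apply_of_le hk le_rfl
  have h1 : k (r + 1) = r + 1 := supp_apply_of_ge hk le_rfl
  rw [periodize_apply hr (mul_mem hh hk) hx hx', RelIso.mul_apply, RelIso.mul_apply,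
    periodize_apply hr hk hx hx', periodize_apply hr hh]
  · exact h0 ▸ k.monotone hx
  · exact h1 ▸ k.monotone hx'

theorem periodize_one (hr : r ∈ goldenRing) : periodize r 1 = 1 := by
  have h := periodize_mul hr (one_mem (supp r (r + 1))) (one_mem _)
  rwa [mul_one, left_eq_mul] at h

theorem periodize_inv (hr : r ∈ goldenRing) (hh : h ∈ supp r (r + 1)) :
    periodize r h⁻¹ = (periodize r h)⁻¹ := by
  rw [eq_inv_iff_mul_eq_one, ← periodize_mul hr (inv_mem hh) hh, inv_mul_cancel, periodize_one hr]

theorem periodize_commutator (hr : r ∈ goldenRing) (hh : h ∈ supp r (r + 1))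
    (hk : k ∈ supp r (r + 1)) : periodize r ⁅h, k⁆ = ⁅periodize r h, periodize r k⁆ := by
  rw [commutatorElement_def, commutatorElement_def,
    periodize_mul hr (mul_mem (mul_mem hh hk) (inv_mem hh)) (inv_mem hk),
    periodize_mul hr (mul_mem hh hk) (inv_mem hh), periodize_mul hr hh hk, periodize_inv hr hh,
    periodize_inv hr hk]

theorem commutator_self_le {K : Type*} [Group K] (S : Subgroup K) : ⁅S, S⁆ ≤ S := by
  rw [Subgroup.commutator_le]
  intro x hx y hy
  exact mul_mem (mul_mem (mul_mem hx hy) (inv_mem hx)) (inv_mem hy)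

theorem periodize_mem_commutator (hr : r ∈ goldenRing)
    (hh : h ∈ ⁅supp r (r + 1), supp r (r + 1)⁆) : periodize r h ∈ ⁅periodic 1, periodic 1⁆ := by
  have hle := commutator_self_le (supp r (r + 1))
  rw [Subgroup.commutator_def] at hh
  induction hh using Subgroup.closure_induction with
  | mem x hx =>
    obtain ⟨F, hF, H, hH, rfl⟩ := hx
    rw [periodize_commutator hr hF hH]
    exact Subgroup.commutator_mem_commutator (periodize_mem _ _) (periodize_mem _ _)
  | one =>
    rw [periodize_one hr]
    exact one_mem _
  | mul x y hx hy ihx ihy =>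
    rw [← Subgroup.commutator_def] at hx hy
    rw [periodize_mul hr (hle hx) (hle hy)]
    exact mul_mem ihx ihy
  | inv x hx ih =>
    rw [← Subgroup.commutator_def] at hx
    rw [periodize_inv hr (hle hx)]
    exact inv_mem ih

theorem periodize_apply_eq_self (hr : r ∈ goldenRing) {u v : ℝ} (hru : r ≤ u) (hv : v ≤ r + 1)
    (hh : h ∈ supp u v) {x : ℝ} (hx : ∀ n : ℤ, ¬(u + n < x ∧ x < v + n)) :
    periodize r h x = x := by
  obtain ⟨n, h1, h2⟩ := exists_int_sub_mem r x
  have h3 : periodize r h (x - n) = x - n := by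
    rw [periodize_apply hr (supp_mono hru hv hh) h1 h2.le]
    refine hh.2 _ ?_
    by_contra! hc
    exact hx n ⟨by linarith, by linarith⟩
  rw [periodic_apply_sub_int (periodize_mem _ _)] at h3
  linarith

end periodize

/-! ### Products of conjugates -/

/-- `f` is a product of at most `n` conjugates of `g` and `g⁻¹` by elements of `N`. -/
def IsProdConj {K : Type*} [Group K] (N : Subgroup K) (g : K) (n : ℕ) (f : K) : Prop :=
  ∃ l : List K, l.length ≤ n ∧
    (∀ h ∈ l, ∃ c ∈ N, h = c * g * c⁻¹ ∨ h = c * g⁻¹ * c⁻¹) ∧ l.prod = f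

section IsProdConj
variable {K : Type*} [Group K] {N : Subgroup K} {g : K}

theorem IsProdConj.mul {n m : ℕ} {f f' : K} (h : IsProdConj N g n f) (h' : IsProdConj N g m f') :
    IsProdConj N g (n + m) (f * f') := by
  obtain ⟨l, hl, hc, rfl⟩ := h
  obtain ⟨l', hl', hc', rfl⟩ := h'
  refine ⟨l ++ l', by rw [List.length_append]; omega, fun x hx => ?_, List.prod_append⟩
  exact (List.mem_append.1 hx).elim (hc x) (hc' x)

theorem IsProdConj.mono {n m : ℕ} {f : K} (h : IsProdConj N g n f) (hnm : n ≤ m) :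
    IsProdConj N g m f := by
  obtain ⟨l, hl, hc⟩ := h
  exact ⟨l, hl.trans hnm, hc⟩

theorem IsProdConj.conj {n : ℕ} {f c : K} (h : IsProdConj N g n f) (hc : c ∈ N) :
    IsProdConj N g n (c * f * c⁻¹) := by
  obtain ⟨l, hl, hd, rfl⟩ := h
  refine ⟨l.map (MulAut.conj c), by simpa using hl, ?_, ?_⟩
  · intro x hx
    obtain ⟨y, hy, rfl⟩ := List.mem_map.1 hx
    obtain ⟨d, hdN, rfl | rfl⟩ := hd y hy
    · refine ⟨c * d, mul_mem hc hdN, Or.inl ?_⟩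
      rw [MulAut.conj_apply]; group
    · refine ⟨c * d, mul_mem hc hdN, Or.inr ?_⟩
      rw [MulAut.conj_apply]; group
  · rw [← map_list_prod]
    rfl

/-- Here `⁅a, g⁆ = a * (g * a⁻¹ * g⁻¹)` and its second factor commutes with `b`, so `⁅a, b⁆ = ⁅⁅a,
g⁆, b⁆`; now `⁅a, g⁆` is two conjugates, and the outer commutator doubles the count. -/
theorem isProdConj_commutator {a b : K} (ha : a ∈ N) (hb : b ∈ N)
    (h : Commute (g * a⁻¹ * g⁻¹) b) : IsProdConj N g 4 ⁅a, b⁆ := by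
  refine ⟨[a * g * a⁻¹, 1 * g⁻¹ * 1⁻¹, b * g * b⁻¹, b * a * g⁻¹ * (b * a)⁻¹], le_rfl, ?_, ?_⟩
  · intro x hx
    simp only [List.mem_cons, List.not_mem_nil, or_false] at hx
    rcases hx with rfl | rfl | rfl | rfl
    · exact ⟨a, ha, Or.inl rfl⟩
    · exact ⟨1, one_mem _, Or.inr rfl⟩
    · exact ⟨b, hb, Or.inl rfl⟩
    · exact ⟨b * a, mul_mem hb ha, Or.inr rfl⟩
  · simp only [List.prod_cons, List.prod_nil]
    calc _ = a * ((g * a⁻¹ * g⁻¹) * b) * (g * a * g⁻¹) * a⁻¹ * b⁻¹ := by group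
      _ = ⁅a, b⁆ := by rw [h.eq, commutatorElement_def]; group

end IsProdConj

theorem commute_of_forall_fixed {p q : ℝ ≃o ℝ} (h : ∀ x, p x = x ∨ q x = x) : Commute p q := by
  ext x
  rw [RelIso.mul_apply, RelIso.mul_apply]
  by_cases hp : p x = x
  · by_cases hq : q x = x
    · rw [hq, hp, hq]
    · have h1 : p (q x) = q x := (h (q x)).resolve_right fun h' => hq (q.injective h')
      rw [h1, hp]
  · have hq : q x = x := (h x).resolve_left hp
    have h1 : q (p x) = p x := (h (p x)).resolve_left fun h' => hp (p.injective h')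
    rw [h1, hq]

/-- The inequalities say that `γ` carries every integer translate of `(u, v)` into a gap between
translates, so `b` and the `γ`-conjugate of `a⁻¹`, once periodized, have disjoint supports. -/
theorem isProdConj_periodize_commutator {γ : ℝ ≃o ℝ} (hγ : γ ∈ periodic 1) {r u v : ℝ}
    (hr : r ∈ goldenRing) (hru : r ≤ u) (hvr : v ≤ r + 1) (h1 : v < γ u) (h2 : γ v < u + 1)
    {a b : ℝ ≃o ℝ} (ha : a ∈ ⁅supp u v, supp u v⁆) (hb : b ∈ ⁅supp u v, supp u v⁆) :
    IsProdConj ⁅periodic 1, periodic 1⁆ γ 4 (periodize r ⁅a, b⁆) := by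
  have hle : supp u v ≤ supp r (r + 1) := supp_mono hru hvr
  have hle' := Subgroup.commutator_mono hle hle
  have ha' := commutator_self_le _ ha
  have hb' := commutator_self_le _ hb
  rw [periodize_commutator hr (hle ha') (hle hb')]
  refine isProdConj_commutator (periodize_mem_commutator hr (hle' ha))
    (periodize_mem_commutator hr (hle' hb)) (commute_of_forall_fixed fun x => ?_)
  rw [← periodize_inv hr (hle ha')]
  by_cases hx : periodize r a⁻¹ (γ⁻¹ x) = γ⁻¹ x
  · left
    rw [RelIso.mul_apply, RelIso.mul_apply, hx, RelIso.apply_inv_self]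
  · right
    have h3 : ∃ n : ℤ, u + n < γ⁻¹ x ∧ γ⁻¹ x < v + n := by
      by_contra! hc
      exact hx (periodize_apply_eq_self hr hru hvr (inv_mem ha') fun n h => (hc n h.1).not_gt h.2)
    obtain ⟨n, h4, h5⟩ := h3
    rw [← γ.lt_iff_lt, RelIso.apply_inv_self, periodic_apply_add_int hγ] at h4 h5
    refine periodize_apply_eq_self hr hru hvr hb' fun m ⟨h6, h7⟩ => ?_
    have h8 : (n : ℝ) < m := by linarith
    have h9 : (m : ℝ) < n + 1 := by linarith
    have h8' : n < m := by exact_mod_cast h8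
    have h9' : m < n + 1 := by exact_mod_cast h9
    omega

/-- The support is conjugated into a small interval displaced by `γ`, where two commutators at four
conjugates each suffice. -/
theorem isProdConj_periodize {γ : ℝ ≃o ℝ} (hγ : γ ∈ periodic 1) {x : ℝ} (hx : x < γ x)
    (hx' : γ x < x + 1) {r a b : ℝ} (hr : r ∈ goldenRing) (ha : a ∈ goldenRing)
    (hb : b ∈ goldenRing) (hra : r < a) (hab : a < b) (hbr : b < r + 1) {F : ℝ ≃o ℝ}
    (hF : F ∈ ⁅bddSupp, bddSupp⁆) (hF' : F ∈ supp a b) :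
    IsProdConj ⁅periodic 1, periodic 1⁆ γ 8 (periodize r F) := by
  obtain ⟨n, hn, hn'⟩ := exists_int_sub_mem r x
  have hγx := periodic_apply_sub_int hγ x n
  have hz1 : x - n < γ (x - n) := by linarith
  have hz2 : x - n < γ⁻¹ (x - n + 1) := by
    rw [← γ.lt_iff_lt, RelIso.apply_inv_self]
    linarith
  generalize x - n = z at hn hn' hz1 hz2
  -- For `z < u < v`, the bound `v < γ z` gives `v < γ u`, and `v < γ⁻¹ (z + 1)` gives `γ v < u +
  -- 1`.
  obtain ⟨v, hv, hzv, hv'⟩ := exists_goldenRing_between (lt_min hn' (lt_min hz1 hz2))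
  rw [lt_min_iff, lt_min_iff] at hv'
  obtain ⟨hv1, hv2, hv3⟩ := hv'
  rw [← γ.lt_iff_lt, RelIso.apply_inv_self] at hv3
  obtain ⟨u, hu, hzu, huv⟩ := exists_goldenRing_between hzv
  obtain ⟨u', hu', huu, hu2⟩ := exists_goldenRing_between huv
  obtain ⟨v', hv', hvv, hv4⟩ := exists_goldenRing_between hu2
  obtain ⟨e, he, hea, heb⟩ := exists_goldenPL_interval ha hb hu' hv' hab hvv
  obtain ⟨k, hk, hke⟩ := exists_commutator_eqOn he hr ha hb (add_mem hr (one_mem _)) hab.le hra hbr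
    (by rw [hea]; linarith) (by rw [heb]; linarith)
  have hk1 := commutator_self_le _ hk
  have hS : k * F * k⁻¹ ∈ supp u' v' := by
    have h1 := supp_conj hF' hk1.1
    rwa [hke a le_rfl hab.le, hke b hab.le le_rfl, hea, heb] at h1
  have hC : k * F * k⁻¹ ∈ ⁅bddSupp, bddSupp⁆ :=
    conj_mem_commutator_of (fun y hy => conj_mem_bddSupp hy hk1.1) hF
  obtain ⟨g, hg, h, hh, A, hA, B, hB, E⟩ := exists_two_commutators hC hS hu hu' hv' hv huu hvv.le hv4
  have hle : supp u v ≤ supp r (r + 1) := supp_mono (by linarith) (by linarith)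
  have hcm : ∀ {a b : ℝ ≃o ℝ}, a ∈ ⁅supp u v, supp u v⁆ → b ∈ ⁅supp u v, supp u v⁆ →
      ⁅a, b⁆ ∈ supp r (r + 1) := fun ha hb => by
    have h1 := commutator_self_le _ (Subgroup.commutator_mem_commutator
      (commutator_self_le _ ha) (commutator_self_le _ hb))
    exact hle h1
  have hγu : v < γ u := hv2.trans (γ.strictMono hzu)
  have hP : IsProdConj ⁅periodic 1, periodic 1⁆ γ 8 (periodize r (k * F * k⁻¹)) := by
    rw [E, periodize_mul hr (hcm hg hh) (hcm hA hB)]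
    exact (isProdConj_periodize_commutator hγ hr (by linarith) hv1.le hγu (by linarith)
      hg hh).mul (isProdConj_periodize_commutator hγ hr (by linarith) hv1.le hγu (by linarith) hA hB)
  have hFr : F ∈ supp r (r + 1) := supp_mono hra.le hbr.le hF'
  rw [periodize_mul hr (mul_mem hk1 hFr) (inv_mem hk1), periodize_mul hr hk1 hFr,
    periodize_inv hr hk1] at hP
  have := hP.conj (inv_mem (periodize_mem_commutator hr hk))
  convert this using 1
  group

/-! ### Decomposition of periodic maps -/

/-- The bound on `f 0` is exactly what puts `0` and `f 0` in a common open unit interval `(r, r +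
1)`, within which `f` can be interpolated near `0`. -/
theorem exists_periodize_eqOn {f : ℝ ≃o ℝ} (hf : f ∈ goldenPL) (h1 : -1 < f 0) (h2 : f 0 < 1) :
    ∃ r a b ε : ℝ, r ∈ goldenRing ∧ a ∈ goldenRing ∧ b ∈ goldenRing ∧ ε ∈ goldenRing ∧ r < a ∧
      a < b ∧ b < r + 1 ∧ 0 < ε ∧ ε < 1 / 2 ∧ ∃ D ∈ ⁅supp a b, supp a b⁆,
      ∀ x, -ε ≤ x → x ≤ ε → periodize r D x = f x := by
  obtain ⟨r, hr, hr1, hr2⟩ := exists_goldenRing_between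
    (show max 0 (f 0) - 1 < min 0 (f 0) by
      rw [sub_lt_iff_lt_add, max_lt_iff, ← min_add_add_right, lt_min_iff, lt_min_iff]
      refine ⟨⟨?_, ?_⟩, ?_, ?_⟩ <;> linarith)
  obtain ⟨a, ha, hra, ha2⟩ := exists_goldenRing_between hr2
  obtain ⟨b, hb, hb1, hbr⟩ := exists_goldenRing_between
    (show max 0 (f 0) < r + 1 by linarith)
  rw [lt_min_iff] at ha2
  rw [max_lt_iff] at hb1
  have hfa : f⁻¹ a < 0 := by
    rw [← f.lt_iff_lt, RelIso.apply_inv_self]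
    exact ha2.2
  have hfb : 0 < f⁻¹ b := by
    rw [← f.lt_iff_lt, RelIso.apply_inv_self]
    exact hb1.2
  obtain ⟨ε, hε, hε0, hε1⟩ := exists_goldenRing_between
    (show 0 < min (min (1 / 2) (min (-a) b)) (min (-f⁻¹ a) (f⁻¹ b)) by
      simp only [lt_min_iff]
      refine ⟨⟨?_, ?_, ?_⟩, ?_, ?_⟩ <;> linarith)
  simp only [lt_min_iff] at hε1
  obtain ⟨⟨e1, e2, e3⟩, e4, e5⟩ := hε1
  have e4' : f⁻¹ a < -ε := by linarith
  rw [← f.lt_iff_lt, RelIso.apply_inv_self] at e4' e5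
  obtain ⟨D, hD, hD'⟩ := exists_commutator_eqOn hf ha (neg_mem hε) hε hb (by linarith)
    (by linarith) e3 e4' e5
  refine ⟨r, a, b, ε, hr, ha, hb, hε, hra, by linarith, hbr, hε0, e1, D, hD, fun x hx hx' => ?_⟩
  rw [periodize_apply hr (supp_mono hra.le hbr.le (commutator_self_le _ hD)) (by linarith)
    (by linarith), hD' x hx hx']

/-- The kernel of `psi 1`. -/
noncomputable def psiKer : Subgroup (ℝ ≃o ℝ) where
  carrier := {F | F ∈ periodic 1 ∧ psi 1 F = 0}
  one_mem' := ⟨one_mem _, psi_eq_zero_of_mem_commutator zero_le_one (one_mem _) (one_mem _)⟩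
  mul_mem' := by
    rintro F H ⟨hF, hF'⟩ ⟨hH, hH'⟩
    exact ⟨mul_mem hF hH, by rw [psi_mul zero_le_one (one_mem _) hF hH, hF', hH', add_zero]⟩
  inv_mem' := by
    rintro F ⟨hF, hF'⟩
    exact ⟨inv_mem hF, by rw [psi_inv zero_le_one (one_mem _) hF, hF', neg_zero]⟩

theorem commutator_le_psiKer : ⁅periodic 1, periodic 1⁆ ≤ psiKer := fun _ h =>
  ⟨commutator_self_le _ h, psi_eq_zero_of_mem_commutator zero_le_one (one_mem _) h⟩

theorem periodize_mem_psiKer {r a b : ℝ} (hr : r ∈ goldenRing) (hra : r ≤ a) (hbr : b ≤ r + 1)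
    {D : ℝ ≃o ℝ} (hD : D ∈ ⁅supp a b, supp a b⁆) : periodize r D ∈ psiKer :=
  commutator_le_psiKer (periodize_mem_commutator hr
    (Subgroup.commutator_mono (supp_mono hra hbr) (supp_mono hra hbr) hD))

theorem isProdConj_sixteen {γ : ℝ ≃o ℝ} (hγ : γ ∈ periodic 1) {x : ℝ} (hx : x < γ x)
    (hx' : γ x < x + 1) {f : ℝ ≃o ℝ} (hf : f ∈ psiKer) (h1 : -1 < f 0) (h2 : f 0 < 1) :
    IsProdConj ⁅periodic 1, periodic 1⁆ γ 16 f := by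
  obtain ⟨r, a, b, ε, hr, ha, hb, hε, hra, hab, hbr, hε0, hε1, D, hD, hDf⟩ :=
    exists_periodize_eqOn hf.1.1 h1 h2
  have hle := supp_le_bddSupp a b
  have P1 := isProdConj_periodize hγ hx hx' hr ha hb hra hab hbr
    (Subgroup.commutator_mono hle hle hD) (commutator_self_le _ hD)
  set d := periodize r D
  have hd : d ∈ psiKer := periodize_mem_psiKer hr hra.le hbr.le hD
  obtain ⟨e, he⟩ : ∃ e, e = d⁻¹ * f := ⟨_, rfl⟩
  have hfe : f = d * e := by rw [he, mul_inv_cancel_left]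
  have heK : e ∈ psiKer := he ▸ mul_mem (inv_mem hd) hf
  have hid : ∀ y, -ε ≤ y → y ≤ ε → e y = y := by
    intro y hy hy'
    rw [he, RelIso.mul_apply, ← hDf y hy hy', RelIso.inv_apply_self]
  -- As `e` fixes `0`, the left part of the splice can be trivial. Then `m` is `e` on `[0, 1]` and
  -- the identity elsewhere, and its class is `psi 1 e = 0`.
  obtain ⟨m, hm⟩ := exists_splice zero_le_one (one_mem _) heK.1 (zero_mem goldenRing)
    (one_mem bddSupp) (hid 0 (by linarith) hε0.le).symm
  have hm0 : cls m = 0 := by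
    have h3 := hm.psi_eq zero_le_one (one_mem _) heK.1 (zero_mem _)
    rw [heK.2, cls_one, sub_zero] at h3
    exact h3.symm
  have hmS : m ∈ supp ε (1 - ε) := by
    refine ⟨bddSupp_le_goldenPL hm.mem, fun y hy => ?_⟩
    rcases hy with hy | hy
    · rcases le_total y 0 with hy0 | hy0
      · rw [hm.le y hy0]; rfl
      · rw [hm.mid y hy0 (by linarith), hid y (by linarith) hy]
    · rcases le_total y 1 with hy1 | hy1
      · have h3 := heK.1.2 (y - 1)
        rw [sub_add_cancel] at h3
        rw [hm.mid y (by linarith) (by linarith), h3, hid _ (by linarith) (by linarith)]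
        ring
      · rw [hm.ge y (by linarith)]
        exact sub_add_cancel y 1
  have hem : e = periodize 0 m := by
    refine periodic_ext heK.1 (periodize_mem _ _) (r := 0) fun y hy hy' => ?_
    rw [periodize_apply (zero_mem _) (supp_mono hε0.le (by linarith) hmS) hy hy',
      hm.mid y hy hy']
  have P2 := isProdConj_periodize hγ hx hx' (zero_mem goldenRing) hε (sub_mem (one_mem _) hε) hε0
    (by linarith) (by linarith) (mem_commutator_of_cls_eq_zero hm.mem hm0) hmS
  rw [hfe, hem]
  exact P1.mul P2

/-- When `f 0 = 1`, a factor `d` acting near `0` as translation by `τ` is split off first. Since `d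
0 = τ < 1 < d 1`, the quotient sends `0` into `(0, 1)`, where 16 conjugates suffice; `d` itself
costs 8. -/
theorem isProdConj_twentyFour {γ : ℝ ≃o ℝ} (hγ : γ ∈ periodic 1) {x : ℝ} (hx : x < γ x)
    (hx' : γ x < x + 1) {f : ℝ ≃o ℝ} (hf : f ∈ psiKer) (h1 : -1 < f 0) (h2 : f 0 ≤ 1) :
    IsProdConj ⁅periodic 1, periodic 1⁆ γ 24 f := by
  rcases h2.lt_or_eq with h2 | h2
  · exact (isProdConj_sixteen hγ hx hx' hf h1 h2).mono (by norm_num)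
  have hτ := smallGolden_pos
  have hτ1 := smallGolden_lt_one
  obtain ⟨r, a, b, ε, hr, ha, hb, hε, hra, hab, hbr, hε0, hε1, D, hD, hDf⟩ :=
    exists_periodize_eqOn (shift_mem smallGolden_mem)
      (by simpa using by linarith) (by simpa using hτ1)
  have hle := supp_le_bddSupp a b
  have P1 := isProdConj_periodize hγ hx hx' hr ha hb hra hab hbr
    (Subgroup.commutator_mono hle hle hD) (commutator_self_le _ hD)
  set d := periodize r D
  have hd : d ∈ psiKer := periodize_mem_psiKer hr hra.le hbr.le hD
  obtain ⟨e, he⟩ : ∃ e, e = d⁻¹ * f := ⟨_, rfl⟩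
  have hfe : f = d * e := by rw [he, mul_inv_cancel_left]
  have heK : e ∈ psiKer := he ▸ mul_mem (inv_mem hd) hf
  have hd0 : d 0 = smallGolden := by
    rw [hDf 0 (by linarith) hε0.le]
    simp
  have hd1 := hd.1.2 0
  have hde : d (e 0) = 1 := by rw [← RelIso.mul_apply, ← hfe, h2]
  have e1 : 0 < e 0 := by
    rw [← d.lt_iff_lt, hde, hd0]
    exact hτ1
  have e2 : e 0 < 1 := by
    rw [← d.lt_iff_lt, hde]
    rw [zero_add] at hd1
    linarith
  rw [hfe]
  exact P1.mul (isProdConj_sixteen hγ hx hx' heK (by linarith) e2)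

theorem shift_zpow (c : ℝ) (n : ℤ) : shift c ^ n = shift (n * c) := by
  induction n using Int.induction_on with
  | zero => ext x; simp
  | succ n ih =>
    rw [zpow_add_one, ih]
    ext x
    simp only [RelIso.mul_apply, shift_apply]
    push_cast
    ring
  | pred n ih =>
    rw [zpow_sub_one, ih]
    ext x
    simp only [RelIso.mul_apply, shift_apply, shift_inv_apply]
    push_cast
    ring

theorem exists_isProdConj_shift {γ : ℝ ≃o ℝ} (hγ : γ ∈ periodic 1) {x : ℝ} (hx : x < γ x)
    (hx' : γ x < x + 1) {f : ℝ ≃o ℝ} (hf : f ∈ ⁅periodic 1, periodic 1⁆) :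
    ∃ n : ℤ, IsProdConj ⁅periodic 1, periodic 1⁆ γ 24 (shift n * f) := by
  have hK : ∀ k : ℤ, shift ((k * 2 : ℤ) : ℝ) ∈ psiKer := by
    intro k
    have h1 : shift 2 ∈ psiKer := ⟨shift_mem_periodic (by exact_mod_cast natCast_mem goldenRing 2) _,
      psi_one_shift_two⟩
    have h2 := zpow_mem h1 k
    rw [shift_zpow] at h2
    exact_mod_cast h2
  -- This rounding brings `f 0` into `(-1, 1]` by an even translation, the kind shown to lie in
  -- `psiKer`.
  refine ⟨-⌈(f 0 - 1) / 2⌉ * 2, isProdConj_twentyFour hγ hx hx'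
    (mul_mem (hK _) (commutator_le_psiKer hf)) ?_ ?_⟩ <;>
  · rw [RelIso.mul_apply, shift_apply]
    push_cast
    have h1 := Int.le_ceil ((f 0 - 1) / 2)
    have h2 := Int.ceil_lt_add_one ((f 0 - 1) / 2)
    linarith

/-! ### Passage to the circle -/

/-- `F` is a lift to the line of the homeomorphism `f` of the circle. -/
def Lifts (F : ℝ ≃o ℝ) (f : UnitAddCircle ≃ₜ UnitAddCircle) : Prop :=
  ∀ x : ℝ, f (x : UnitAddCircle) = (F x : UnitAddCircle)

theorem unitAddCircle_coe_eq_iff {x y : ℝ} :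
    (x : UnitAddCircle) = y ↔ ∃ n : ℤ, x = y + n := by
  rw [← sub_eq_zero, ← AddCircle.coe_sub, AddCircle.coe_eq_zero_iff]
  constructor
  · rintro ⟨n, hn⟩
    rw [zsmul_one] at hn
    exact ⟨n, by linarith⟩
  · rintro ⟨n, hn⟩
    exact ⟨n, by rw [zsmul_one]; linarith⟩

theorem unitAddCircle_coe_add_int (x : ℝ) (n : ℤ) : ((x + n : ℝ) : UnitAddCircle) = x :=
  unitAddCircle_coe_eq_iff.2 ⟨n, rfl⟩

theorem coe_mem_goldenPoints_iff {x : ℝ} : (x : UnitAddCircle) ∈ goldenPoints ↔ x ∈ goldenRing := by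
  constructor
  · rintro ⟨y, hy, e⟩
    obtain ⟨n, rfl⟩ := unitAddCircle_coe_eq_iff.1 e
    have h1 : x + n ∈ goldenRing := hy
    simpa using sub_mem h1 (intCast_mem goldenRing n)
  · intro hx
    exact ⟨x, hx, rfl⟩

theorem exists_coe_eq (q : UnitAddCircle) : ∃ x : ℝ, (x : UnitAddCircle) = q :=
  QuotientAddGroup.mk_surjective q

theorem Lifts.mul {F H : ℝ ≃o ℝ} {f h : UnitAddCircle ≃ₜ UnitAddCircle} (hF : Lifts F f)
    (hH : Lifts H h) : Lifts (F * H) (f * h) := by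
  intro x
  change f (h x) = _
  rw [hH, hF]
  rfl

theorem Lifts.inv {F : ℝ ≃o ℝ} {f : UnitAddCircle ≃ₜ UnitAddCircle} (hF : Lifts F f) :
    Lifts F⁻¹ f⁻¹ := by
  intro x
  apply f.injective
  rw [hF, RelIso.apply_inv_self]
  exact f.apply_symm_apply _

theorem Lifts.one : Lifts 1 1 := fun _ => rfl

theorem Lifts.unique {F : ℝ ≃o ℝ} {f h : UnitAddCircle ≃ₜ UnitAddCircle} (hf : Lifts F f)
    (hh : Lifts F h) : f = h := by
  ext q
  obtain ⟨x, rfl⟩ := exists_coe_eq q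
  rw [hf, hh]

theorem Lifts.shift_mul {F : ℝ ≃o ℝ} {f : UnitAddCircle ≃ₜ UnitAddCircle} (hf : Lifts F f)
    (n : ℤ) : Lifts (shift n * F) f := by
  intro x
  rw [RelIso.mul_apply, shift_apply, unitAddCircle_coe_add_int, hf]

theorem exists_lifts {F : ℝ ≃o ℝ} (hF : F ∈ periodic 1) :
    ∃ f : UnitAddCircle ≃ₜ UnitAddCircle, Lifts F f := by
  have key : ∀ H ∈ periodic 1, ∃ h : UnitAddCircle → UnitAddCircle, Continuous h ∧
      ∀ x : ℝ, h x = (H x : UnitAddCircle) := by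
    intro H hH
    have e : ∀ x : ℝ, ((H (exists_coe_eq (x : UnitAddCircle)).choose : ℝ) : UnitAddCircle) =
        (H x : UnitAddCircle) := by
      intro x
      obtain ⟨n, hn⟩ := unitAddCircle_coe_eq_iff.1 (exists_coe_eq (x : UnitAddCircle)).choose_spec
      rw [hn, periodic_apply_add_int hH, unitAddCircle_coe_add_int]
    refine ⟨fun q => (H (exists_coe_eq q).choose : UnitAddCircle), ?_, e⟩
    have hq : Topology.IsQuotientMap (fun x : ℝ => (x : UnitAddCircle)) :=
      QuotientAddGroup.isQuotientMap_mk _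
    rw [hq.continuous_iff]
    have : (fun q : UnitAddCircle => ((H (exists_coe_eq q).choose : ℝ) : UnitAddCircle)) ∘
        (fun x : ℝ => (x : UnitAddCircle)) = fun x : ℝ => (H x : UnitAddCircle) := funext e
    rw [this]
    exact hq.continuous.comp H.continuous
  obtain ⟨f, hf, hfF⟩ := key F hF
  obtain ⟨g, hg, hgF⟩ := key F⁻¹ (inv_mem hF)
  refine ⟨⟨⟨f, g, fun q => ?_, fun q => ?_⟩, hf, hg⟩, hfF⟩
  · obtain ⟨x, rfl⟩ := exists_coe_eq q
    rw [hfF, hgF, RelIso.inv_apply_self]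
  · obtain ⟨x, rfl⟩ := exists_coe_eq q
    rw [hgF, hfF, RelIso.apply_inv_self]

theorem Lifts.hasSlopeAt {F : ℝ ≃o ℝ} {f : UnitAddCircle ≃ₜ UnitAddCircle} (hf : Lifts F f)
    {s x : ℝ} (h : ∀ᶠ y in 𝓝 x, F y = F x + s * (y - x)) : HasSlopeAt f s x := by
  have hlim : Filter.Tendsto (fun t : ℝ => x + t) (𝓝 0) (𝓝 x) := by
    have h : Continuous (fun t : ℝ => x + t) := by fun_prop
    simpa using h.tendsto 0
  filter_upwards [hlim.eventually h] with t ht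
  rw [← AddCircle.coe_add, hf, ht, hf, ← AddCircle.coe_add, add_sub_cancel_left]

/-- The circle identity determines `F y` up to an integer, which continuity forces to vanish near
`x`. -/
theorem Lifts.eventually_of_hasSlopeAt {F : ℝ ≃o ℝ} {f : UnitAddCircle ≃ₜ UnitAddCircle}
    (hf : Lifts F f) {s x : ℝ} (h : HasSlopeAt f s x) :
    ∀ᶠ y in 𝓝 x, F y = F x + s * (y - x) := by
  have hlim : Filter.Tendsto (fun y : ℝ => y - x) (𝓝 x) (𝓝 0) := by
    have h : Continuous (fun y : ℝ => y - x) := by fun_prop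
    simpa using h.tendsto x
  have hlim2 : Filter.Tendsto (fun y : ℝ => F y - (F x + s * (y - x))) (𝓝 x) (𝓝 0) := by
    have hF := F.continuous
    have h : Continuous (fun y : ℝ => F y - (F x + s * (y - x))) := by fun_prop
    simpa using h.tendsto x
  filter_upwards [hlim.eventually h,
    hlim2.eventually (Ioo_mem_nhds (show (-1 : ℝ) < 0 by norm_num) one_pos)] with y h1 h2
  rw [← AddCircle.coe_add, hf, hf, ← AddCircle.coe_add, add_sub_cancel] at h1
  obtain ⟨n, hn⟩ := unitAddCircle_coe_eq_iff.1 h1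
  rw [hn, add_sub_cancel_left] at h2
  have h3 : -1 < n := by exact_mod_cast h2.1
  have h4 : n < 1 := by exact_mod_cast h2.2
  have h5 : n = 0 := by omega
  rw [hn, h5]
  simp

/-! ### Breakpoints and slopes of lifts -/

/-- Breakpoints cannot accumulate at `x`: one-sided affinity at `x` makes `F` affine near every
other point close to `x`. -/
theorem finite_breakpoints {F : ℝ ≃o ℝ} (hF : F ∈ goldenPL) (a b : ℝ) :
    ({x | ¬∃ n : ℤ, ∀ᶠ y in 𝓝 x, F y = F x + smallGolden ^ n * (y - x)} ∩ Set.Icc a b).Finite := by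
  by_contra hinf
  obtain ⟨x, -, hx⟩ := Set.Infinite.exists_accPt_of_subset_isCompact hinf isCompact_Icc
    Set.inter_subset_right
  rw [accPt_iff_frequently] at hx
  have aux : ∀ (n : ℤ) (y : ℝ), (∀ᶠ z in 𝓝 y, F z = F x + smallGolden ^ n * (z - x)) →
      ∃ n : ℤ, ∀ᶠ z in 𝓝 y, F z = F y + smallGolden ^ n * (z - y) := by
    intro n y h
    refine ⟨n, ?_⟩
    have hy := h.self_of_nhds
    filter_upwards [h] with z hz
    rw [hz, hy]
    ring
  obtain ⟨n, hn⟩ := (hF.2 x).right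
  obtain ⟨m, hm⟩ := (hF.2 x).left
  obtain ⟨c, hc, hcn⟩ := mem_nhdsGE_iff_exists_Ico_subset.1 hn
  obtain ⟨d, hd, hdm⟩ := mem_nhdsLE_iff_exists_Ioc_subset.1 hm
  refine hx ?_
  filter_upwards [Ioo_mem_nhds hd hc] with y hy
  rintro ⟨hyx, hyb, -⟩
  apply hyb
  rcases lt_or_gt_of_ne hyx with h | h
  · refine aux m y ?_
    filter_upwards [Ioo_mem_nhds hy.1 h] with z hz
    exact hdm ⟨hz.1, hz.2.le⟩
  · refine aux n y ?_
    filter_upwards [Ioo_mem_nhds h hy.2] with z hz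
    exact hcn ⟨hz.1.le, hz.2⟩

theorem Lifts.mem_goldenT {F : ℝ ≃o ℝ} (hF : F ∈ periodic 1) {f : UnitAddCircle ≃ₜ UnitAddCircle}
    (hf : Lifts F f) : f ∈ goldenT := by
  refine ⟨⟨⟨⟨⟨F, F.monotone⟩, hF.2⟩, ⟨⟨(F⁻¹ : ℝ ≃o ℝ), OrderIso.monotone _⟩, (inv_mem hF).2⟩,
      ?_, ?_⟩, hf⟩, ?_, ?_⟩
  · ext x
    exact F.apply_inv_self x
  · ext x
    exact F.inv_apply_self x
  · refine ⟨_, (finite_breakpoints hF.1 0 1).image (fun x : ℝ => (x : UnitAddCircle)), ?_, ?_⟩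
    · rintro _ ⟨x, ⟨hx, -⟩, rfl⟩
      rw [coe_mem_goldenPoints_iff]
      by_contra h
      exact hx ((hF.1.2 x).both h)
    · intro q hq
      obtain ⟨y, rfl⟩ := exists_coe_eq q
      obtain ⟨n, hn, hn'⟩ := exists_int_sub_mem 0 y
      have e : ((y - n : ℝ) : UnitAddCircle) = y := by
        conv_rhs => rw [← sub_add_cancel y (n : ℝ), unitAddCircle_coe_add_int]
      rw [← e] at hq ⊢
      by_contra! hc
      refine hq ⟨y - n, ⟨?_, hn, by linarith⟩, rfl⟩
      rintro ⟨k, hk⟩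
      exact hc k (hf.hasSlopeAt hk)
  · ext q
    obtain ⟨x, rfl⟩ := exists_coe_eq q
    constructor
    · rintro ⟨q', hq', e⟩
      obtain ⟨y, rfl⟩ := exists_coe_eq q'
      rw [← e, hf, coe_mem_goldenPoints_iff, hF.1.1]
      exact coe_mem_goldenPoints_iff.1 hq'
    · intro hx
      refine ⟨((F⁻¹ x : ℝ) : UnitAddCircle), ?_, ?_⟩
      · rw [coe_mem_goldenPoints_iff, ← hF.1.1, RelIso.apply_inv_self]
        exact coe_mem_goldenPoints_iff.1 hx
      · rw [hf, RelIso.apply_inv_self]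

/-- The derivative is locally constant, hence constant on the connected open interval; continuity
extends the affine formula to the end points. -/
theorem affineOn_of_forall_slope {F : ℝ → ℝ} (hF : Continuous F) {a b : ℝ} (hab : a < b)
    (h : ∀ x ∈ Set.Ioo a b, ∃ n : ℤ, ∀ᶠ y in 𝓝 x, F y = F x + smallGolden ^ n * (y - x)) :
    ∃ n : ℤ, ∀ y ∈ Set.Icc a b, ∀ z ∈ Set.Icc a b, F z = F y + smallGolden ^ n * (z - y) := by
  have hd : ∀ (s x y : ℝ), HasDerivAt (fun z => F x + s * (z - x)) s y := by
    intro s x y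
    simpa using (((hasDerivAt_id y).sub_const x).const_mul s).const_add (F x)
  have hder : ∀ x ∈ Set.Ioo a b, ∀ n : ℤ,
      (∀ᶠ y in 𝓝 x, F y = F x + smallGolden ^ n * (y - x)) →
      ∀ᶠ y in 𝓝 x, HasDerivAt F (smallGolden ^ n) y := by
    intro x _ n hn
    filter_upwards [hn.eventually_nhds] with y hy
    exact (hd _ x y).congr_of_eventuallyEq hy
  have hdF : ∀ x ∈ Set.Ioo a b, DifferentiableAt ℝ F x := by
    intro x hx
    obtain ⟨n, hn⟩ := h x hx
    exact (hder x hx n hn).self_of_nhds.differentiableAt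
  have hdd : ∀ x ∈ Set.Ioo a b, HasDerivAt (deriv F) 0 x := by
    intro x hx
    obtain ⟨n, hn⟩ := h x hx
    refine (hasDerivAt_const x (smallGolden ^ n)).congr_of_eventuallyEq ?_
    filter_upwards [hder x hx n hn] with y hy
    exact hy.deriv
  obtain ⟨x₀, hx₀⟩ := exists_between hab
  obtain ⟨n, hn⟩ := h x₀ hx₀
  have h0 : deriv F x₀ = smallGolden ^ n := (hder x₀ hx₀ n hn).self_of_nhds.deriv
  have hconst : ∀ x ∈ Set.Ioo a b, deriv F x = smallGolden ^ n := by
    intro x hx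
    rw [← h0]
    exact isOpen_Ioo.is_const_of_deriv_eq_zero isPreconnected_Ioo
      (fun y hy => (hdd y hy).differentiableAt.differentiableWithinAt)
      (fun y hy => (hdd y hy).deriv) hx hx₀
  have haff : ∀ x ∈ Set.Ioo a b, F x - smallGolden ^ n * x = F x₀ - smallGolden ^ n * x₀ := by
    intro x hx
    have hg : ∀ y ∈ Set.Ioo a b, HasDerivAt (fun z => F z - smallGolden ^ n * z) 0 y := by
      intro y hy
      have h1 := (hdF y hy).hasDerivAt.sub ((hasDerivAt_id y).const_mul (smallGolden ^ n))
      rw [hconst y hy, mul_one, sub_self] at h1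
      exact h1
    exact isOpen_Ioo.is_const_of_deriv_eq_zero (f := fun z => F z - smallGolden ^ n * z)
      isPreconnected_Ioo (fun y hy => (hg y hy).differentiableAt.differentiableWithinAt)
      (fun y hy => (hg y hy).deriv) hx hx₀
  have hcl : IsClosed {x | F x - smallGolden ^ n * x = F x₀ - smallGolden ^ n * x₀} :=
    isClosed_eq (by fun_prop) continuous_const
  have hsub := hcl.closure_subset_iff.2 haff
  rw [closure_Ioo hab.ne] at hsub
  refine ⟨n, fun y hy z hz => ?_⟩
  have h1 : F y - smallGolden ^ n * y = _ := hsub hy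
  have h2 : F z - smallGolden ^ n * z = _ := hsub hz
  linear_combination h2 - h1

theorem exists_lift_of_mem_goldenT {f : UnitAddCircle ≃ₜ UnitAddCircle} (hf : f ∈ goldenT) :
    ∃ F ∈ periodic 1, Lifts F f := by
  obtain ⟨⟨F₀, hF₀⟩, ⟨B, hBf, hBM, hB⟩, hM⟩ := hf
  obtain ⟨F, hF⟩ : ∃ F : ℝ ≃o ℝ, ∀ x, F x = (F₀ : CircleDeg1Lift) x :=
    ⟨CircleDeg1Lift.toOrderIso F₀, fun x => by simp⟩
  have hL : Lifts F f := fun x => by rw [hF₀, hF]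
  have hgood : ∀ x : ℝ, (x : UnitAddCircle) ∉ B →
      ∃ n : ℤ, ∀ᶠ y in 𝓝 x, F y = F x + smallGolden ^ n * (y - x) := by
    intro x hx
    obtain ⟨n, hn⟩ := hB _ hx
    exact ⟨n, hL.eventually_of_hasSlopeAt hn⟩
  have hiso : ∀ x : ℝ, ∃ c d : ℝ, c < x ∧ x < d ∧
      (∀ y, c < y → y < d → y ≠ x → (y : UnitAddCircle) ∉ B) := by
    intro x
    have h1 : {y : ℝ | (y : UnitAddCircle) ∉ B \ {(x : UnitAddCircle)}} ∈ 𝓝 x := by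
      have h2 : IsOpen (B \ {(x : UnitAddCircle)})ᶜ := (hBf.subset Set.sdiff_subset).isClosed.isOpen_compl
      exact (h2.preimage (AddCircle.continuous_mk' 1)).mem_nhds (fun h => h.2 rfl)
    obtain ⟨c, d, hx, hcd⟩ := mem_nhds_iff_exists_Ioo_subset.1 h1
    -- Staying within distance `1` of `x` excludes the other lifts of the same circle point.
    refine ⟨max c (x - 1), min d (x + 1), max_lt hx.1 (by linarith), lt_min hx.2 (by linarith),
      fun y hy hy' hyx hyB => ?_⟩
    rw [max_lt_iff] at hy
    rw [lt_min_iff] at hy'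
    refine hcd ⟨hy.1, hy'.1⟩ ⟨hyB, fun e => hyx ?_⟩
    obtain ⟨n, rfl⟩ := unitAddCircle_coe_eq_iff.1 (Set.mem_singleton_iff.1 e)
    have h3 : (-1 : ℝ) < n := by linarith
    have h4 : (n : ℝ) < 1 := by linarith
    have h3' : -1 < n := by exact_mod_cast h3
    have h4' : n < 1 := by exact_mod_cast h4
    have h5 : n = 0 := by omega
    simp [h5]
  refine ⟨F, ⟨⟨fun x => ?_, fun x => ?_⟩, fun x => ?_⟩, hL⟩
  · rw [← coe_mem_goldenPoints_iff, ← coe_mem_goldenPoints_iff, ← hL]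
    conv_lhs => rw [← hM]
    exact f.injective.mem_set_image
  · obtain ⟨c, d, hc, hd, hcd⟩ := hiso x
    refine ⟨?_, ?_, fun hx => hgood x fun h => hx (coe_mem_goldenPoints_iff.1 (hBM h))⟩
    · obtain ⟨n, hn⟩ := affineOn_of_forall_slope F.continuous hd
        (fun y hy => hgood y (hcd y (hc.trans hy.1) hy.2 hy.1.ne'))
      refine ⟨n, ?_⟩
      filter_upwards [Icc_mem_nhdsGE hd] with y hy
      exact hn x (Set.left_mem_Icc.2 hd.le) y hy
    · obtain ⟨n, hn⟩ := affineOn_of_forall_slope F.continuous hc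
        (fun y hy => hgood y (hcd y hy.1 (hy.2.trans hd) hy.2.ne))
      refine ⟨n, ?_⟩
      filter_upwards [Icc_mem_nhdsLE hc] with y hy
      exact hn x (Set.right_mem_Icc.2 hc.le) y hy
  · rw [hF, hF]
    exact CircleDeg1Lift.map_add_one _ _

/-! ### Commutator subgroups -/

theorem exists_lifts_commutator {c : ℝ ≃o ℝ} (hc : c ∈ ⁅periodic 1, periodic 1⁆) :
    ∃ d ∈ commutator goldenT, Lifts c (d : UnitAddCircle ≃ₜ UnitAddCircle) := by
  rw [Subgroup.commutator_def] at hc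
  induction hc using Subgroup.closure_induction with
  | mem x hx =>
    obtain ⟨F, hF, H, hH, rfl⟩ := hx
    obtain ⟨f, hf⟩ := exists_lifts hF
    obtain ⟨h, hh⟩ := exists_lifts hH
    exact ⟨⁅⟨f, hf.mem_goldenT hF⟩, ⟨h, hh.mem_goldenT hH⟩⁆,
      Subgroup.commutator_mem_commutator (Subgroup.mem_top _) (Subgroup.mem_top _),
      ((hf.mul hh).mul hf.inv).mul hh.inv⟩
  | one => exact ⟨1, one_mem _, Lifts.one⟩
  | mul x y _ _ hx hy =>
    obtain ⟨a, ha, ha'⟩ := hx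
    obtain ⟨b, hb, hb'⟩ := hy
    exact ⟨a * b, mul_mem ha hb, ha'.mul hb'⟩
  | inv x _ hx =>
    obtain ⟨a, ha, ha'⟩ := hx
    exact ⟨a⁻¹, inv_mem ha, ha'.inv⟩

theorem exists_commutator_lift {f : goldenT} (hf : f ∈ commutator goldenT) :
    ∃ F ∈ ⁅periodic 1, periodic 1⁆, Lifts F (f : UnitAddCircle ≃ₜ UnitAddCircle) := by
  rw [commutator_def, Subgroup.commutator_def] at hf
  induction hf using Subgroup.closure_induction with
  | mem x hx =>
    obtain ⟨f, -, h, -, rfl⟩ := hx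
    obtain ⟨F, hF, hFf⟩ := exists_lift_of_mem_goldenT f.2
    obtain ⟨H, hH, hHh⟩ := exists_lift_of_mem_goldenT h.2
    exact ⟨⁅F, H⁆, Subgroup.commutator_mem_commutator hF hH,
      ((hFf.mul hHh).mul hFf.inv).mul hHh.inv⟩
  | one => exact ⟨1, one_mem _, Lifts.one⟩
  | mul x y _ _ hx hy =>
    obtain ⟨a, ha, ha'⟩ := hx
    obtain ⟨b, hb, hb'⟩ := hy
    exact ⟨a * b, mul_mem ha hb, ha'.mul hb'⟩
  | inv x _ hx =>
    obtain ⟨a, ha, ha'⟩ := hx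
    exact ⟨a⁻¹, inv_mem ha, ha'.inv⟩

theorem exists_displacing_lift {g : UnitAddCircle ≃ₜ UnitAddCircle} (hg : g ∈ goldenT)
    (h1 : g ≠ 1) : ∃ γ ∈ periodic 1, Lifts γ g ∧ ∃ x, x < γ x ∧ γ x < x + 1 := by
  obtain ⟨γ, hγ, hL⟩ := exists_lift_of_mem_goldenT hg
  obtain ⟨x, hx⟩ : ∃ x, ∀ n : ℤ, γ x ≠ x + n := by
    by_contra! hc
    refine h1 ?_
    ext q
    obtain ⟨x, rfl⟩ := exists_coe_eq q
    obtain ⟨n, hn⟩ := hc x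
    rw [hL, hn, unitAddCircle_coe_add_int]
    rfl
  -- The new displacement of `x` is the fractional part of `γ x - x`, nonzero because the image of
  -- `x` on the circle is moved by `g`.
  refine ⟨shift ((-⌊γ x - x⌋ : ℤ) : ℝ) * γ,
    mul_mem (shift_mem_periodic (intCast_mem _ _) _) hγ, hL.shift_mul _, x, ?_, ?_⟩ <;>
  rw [RelIso.mul_apply, shift_apply] <;> push_cast
  · have h2 := Int.floor_le (γ x - x)
    rcases h2.lt_or_eq with h2 | h2
    · linarith
    · exact absurd (by linarith) (hx ⌊γ x - x⌋)
  · linarith [Int.lt_floor_add_one (γ x - x)]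

theorem exists_list_lifts {γ : ℝ ≃o ℝ} {g : commutator goldenT}
    (hg : Lifts γ ((g : goldenT) : UnitAddCircle ≃ₜ UnitAddCircle)) (l : List (ℝ ≃o ℝ))
    (hl : ∀ h ∈ l, ∃ c ∈ ⁅periodic 1, periodic 1⁆, h = c * γ * c⁻¹ ∨ h = c * γ⁻¹ * c⁻¹) :
    ∃ l' : List (commutator goldenT), l'.length = l.length ∧
      (∀ h ∈ l', IsConj g h ∨ IsConj g⁻¹ h) ∧
      Lifts l.prod ((l'.prod : goldenT) : UnitAddCircle ≃ₜ UnitAddCircle) := by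
  induction l with
  | nil => exact ⟨[], rfl, by simp, Lifts.one⟩
  | cons h l ih =>
    obtain ⟨l', hlen, hconj, hlift⟩ := ih fun k hk => hl k (List.mem_cons_of_mem _ hk)
    obtain ⟨c, hc, e⟩ := hl h List.mem_cons_self
    obtain ⟨d, hd, hdc⟩ := exists_lifts_commutator hc
    rcases e with rfl | rfl
    · refine ⟨(⟨d, hd⟩ * g * ⟨d, hd⟩⁻¹) :: l', by simp [hlen], ?_, ?_⟩
      · intro k hk
        rcases List.mem_cons.1 hk with rfl | hk
        · exact Or.inl (isConj_iff.2 ⟨_, rfl⟩)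
        · exact hconj k hk
      · rw [List.prod_cons, List.prod_cons]
        exact ((hdc.mul hg).mul hdc.inv).mul hlift
    · refine ⟨(⟨d, hd⟩ * g⁻¹ * ⟨d, hd⟩⁻¹) :: l', by simp [hlen], ?_, ?_⟩
      · intro k hk
        rcases List.mem_cons.1 hk with rfl | hk
        · exact Or.inr (isConj_iff.2 ⟨_, rfl⟩)
        · exact hconj k hk
      · rw [List.prod_cons, List.prod_cons]
        exact ((hdc.mul hg.inv).mul hdc.inv).mul hlift

theorem isNUniformlySimple_commutator_goldenT : IsNUniformlySimple 24 (commutator goldenT) := by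
  intro f g _ hg
  have hg' : ((g : goldenT) : UnitAddCircle ≃ₜ UnitAddCircle) ≠ 1 := fun h =>
    hg (Subtype.ext (Subtype.ext h))
  obtain ⟨γ, hγ, hγg, x, hx, hx'⟩ := exists_displacing_lift g.1.2 hg'
  obtain ⟨F, hF, hFf⟩ := exists_commutator_lift f.2
  obtain ⟨n, l, hlen, hl, hprod⟩ := exists_isProdConj_shift hγ hx hx' hF
  obtain ⟨l', hlen', hconj, hlift⟩ := exists_list_lifts hγg l hl
  refine ⟨l', hlen' ▸ hlen, hconj, Subtype.ext (Subtype.ext ?_)⟩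
  rw [hprod] at hlift
  -- The integer translation introduced to normalize the lift disappears on the circle.
  exact hlift.unique (hFf.shift_mul n)

theorem proposition3p9 :
    IsUniformlySimple (commutator goldenT) ∧ IsNUniformlySimple 24 (commutator goldenT) :=
  ⟨⟨24, isNUniformlySimple_commutator_goldenT⟩, isNUniformlySimple_commutator_goldenT⟩
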